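/- Let $M$ be a finite-dimensional smooth manifold and let $\omega\in\Omega^4(M)$ be a 3-plectic form, i.e. $d\omega=0$ and, for every $x\in M$ and $v\in T_xM$, $\iota(v)\omega_x=0$ implies $v=0$. A 2-form $\alpha$ is called Hamiltonian if there is a (then unique) smooth vector field $v_\alpha$ with $d\alpha=-\iota(v_\alpha)\omega$; for forms $\alpha$ of degree $0$ or $1$ put $v_\alpha=0$. Let $L$ be the three-term chain complex $$\Omega^2_{\mathrm{Ham}}(M)\xleftarrow{\ d\ }\Omega^1(M)\xleftarrow{\ d\ }\Omega^0(M)=C^\infty(M)$$ in degrees $0,1,2$, with the de Rham differential. Write $\iota(v_1,\dots,v_k)=\iota(v_k)\cdots\iota(v_1)$ and $\mathcal L(v)$ for the Lie derivative; a contraction of a $0$-form, or a value lying outside the degrees $0,1,2$, is $0$. Recall the following notions; all maps are graded multilinear, $\partial(f)=d\circ f-(-1)^{|f|}f\circ d$, $f\circ_i g$ is the insertion of $g$ in the $i$-th slot of $f$, $f^\sigma(x_1,\dots,x_n)=\pm f(x_{\sigma^{-1}(1)},\dots,x_{\sigma^{-1}(n)})$, and Koszul signs are used throughout. A weak Lie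 3-algebra is a three-term complex $L_0\leftarrow L_1\leftarrow L_2$ with maps $\lambda_2$ (degree $0$, arity $2$), $\lambda_{2;1}$ (degree $1$, arity $2$), $\lambda_{2;1,1}$ (degree $2$, arity $2$), $\lambda_3$ (degree $1$, arity $3$), $\lambda_{3;1},\lambda_{3;2}$ (degree $2$, arity $3$), $\lambda_4$ (degree $2$, arity $4$) such that $(\lambda_2,\lambda_3,\lambda_4)$ is a homotopy Leibniz algebra structure, i.e. $$\partial(\lambda_2) = 0,$$ $$\partial(\lambda_3) = \lambda_2\circ_2\lambda_2 - \lambda_2\circ_1\lambda_2 - (\lambda_2\circ_2\lambda_2)^{(12)},$$ $$\partial(\lambda_4) = \lambda_2\circ_1\lambda_3 + \lambda_2\circ_2\lambda_3 - (\lambda_2\circ_2\lambda_3)^{(12)} + (\lambda_2\circ_2\lambda_3)^{(123)} - \lambda_3\circ_1\lambda_2 + \lambda_3\circ_2\lambda_2 - (\lambda_3\circ_2\lambda_2)^{(12)} - \lambda_3\circ_3\lambda_2 + (\lambda_3\circ_3\lambda_2)^{(23)} - (\lambda_3\circ_3\lambda_2)^{(132)},$$ $$0 = \lambda_2\circ_1\lambda_4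 - \lambda_2\circ_2\lambda_4 + (\lambda_2\circ_2\lambda_4)^{(12)} - (\lambda_2\circ_2\lambda_4)^{(123)} + (\lambda_2\circ_2\lambda_4)^{(1234)} + \lambda_3\circ_1\lambda_3 + \lambda_3\circ_2\lambda_3 - (\lambda_3\circ_2\lambda_3)^{(12)} + (\lambda_3\circ_2\lambda_3)^{(123)} + \lambda_3\circ_3\lambda_3 - (\lambda_3\circ_3\lambda_3)^{(23)} + (\lambda_3\circ_3\lambda_3)^{(132)} + (\lambda_3\circ_3\lambda_3)^{(234)} - (\lambda_3\circ_3\lambda_3)^{(1342)} + (\lambda_3\circ_3\lambda_3)^{(13)(24)} + \lambda_4\circ_1\lambda_2 - \lambda_4\circ_2\lambda_2 + (\lambda_4\circ_2\lambda_2)^{(12)} + \lambda_4\circ_3\lambda_2 - (\lambda_4\circ_3\lambda_2)^{(23)} + (\lambda_4\circ_3\lambda_2)^{(132)} - \lambda_4\circ_4\lambda_2 + (\lambda_4\circ_4\lambda_2)^{(34)} - (\lambda_4\circ_4\lambda_2)^{(243)} + (\lambda_4\circ_4\lambda_2)^{(1432)},$$ and $$\partial\lambda_{2;1}=\lambda_2+\lambda_2^{(12)},\quad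 \partial\lambda_{2;1,1}=\lambda_{2;1}-\lambda_{2;1}^{(12)},\quad \lambda_{2;1,1}+\lambda_{2;1,1}^{(12)}=0,$$ $$\partial\lambda_{3;1}=\lambda_3+\lambda_3^{(12)}+\lambda_2\circ_1\lambda_{2;1},\qquad \lambda_{3;1}-\lambda_{3;1}^{(12)}=\lambda_2\circ_1\lambda_{2;1,1},$$ $$\partial\lambda_{3;2}=\lambda_3+\lambda_3^{(23)}-\lambda_2\circ_2\lambda_{2;1}+\lambda_{2;1}\circ_1\lambda_2+(\lambda_{2;1}\circ_2\lambda_2)^{(12)},$$ $$\lambda_{3;2}-\lambda_{3;2}^{(23)}=-\lambda_2\circ_2\lambda_{2;1,1}+\lambda_{2;1,1}\circ_1\lambda_2+(\lambda_{2;1,1}\circ_2\lambda_2)^{(12)},$$ $$\lambda_{3;1}-\lambda_{3;2}^{(12)}+\lambda_{3;1}^{(132)}-\lambda_{3;2}+\lambda_{3;1}^{(23)}-\lambda_{3;2}^{(123)}=\lambda_{2;1}\circ_2\lambda_{2;1}+\lambda_{2;1}\circ_1\lambda_{2;1}+(\lambda_{2;1}\circ_2\lambda_{2;1})^{(12)}+(\lambda_{2;1,1}\circ_2\lambda_2)^{(132)},$$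 $$\lambda_4+\lambda_4^{(12)}=\lambda_2\circ_1\lambda_{3;1}-\lambda_{3;1}\circ_3\lambda_2+(\lambda_2\circ_2\lambda_{3;1})^{(123)}+\lambda_3\circ_1\lambda_{2;1},$$ $$\lambda_4+\lambda_4^{(23)}=\lambda_2\circ_1\lambda_{3;2}-\lambda_3\circ_2\lambda_{2;1}+\lambda_2\circ_2\lambda_{3;1}-\lambda_{3;1}\circ_1\lambda_2-(\lambda_{3;1}\circ_2\lambda_2)^{(12)}-(\lambda_{3;1}\circ_3\lambda_2)^{(132)},$$ $$\begin{aligned}\lambda_4+\lambda_4^{(34)}={}&\lambda_{2;1}\circ_1\lambda_3-\lambda_{3;2}\circ_1\lambda_2+\lambda_{3;2}\circ_2\lambda_2-(\lambda_{3;2}\circ_2\lambda_2)^{(12)}+\lambda_3\circ_3\lambda_{2;1}+(\lambda_{3;2}\circ_3\lambda_2)^{(23)}\\&-(\lambda_{3;2}\circ_3\lambda_2)^{(132)}+\lambda_2\circ_2\lambda_{3;2}-(\lambda_2\circ_2\lambda_{3;2})^{(12)}+(\lambda_{2;1}\circ_2\lambda_3)^{(123)}.\end{aligned}$$ A weak morphism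 $(L,\lambda)\to(L',\lambda')$ consists of maps $f_1$ (degree $0$, arity $1$), $f_2$ (degree $1$, arity $2$), $f_{2;1}$ (degree $2$, arity $2$), $f_3$ (degree $2$, arity $3$) such that $(f_1,f_2,f_3)$ is a homotopy morphism of homotopy Leibniz algebras, i.e. $$\partial(f_1) = 0,$$ $$\partial(f_2) = f_1\circ\lambda_2 - \lambda'_2\circ(f_1,f_1),$$ $$\partial(f_3) = f_1\circ\lambda_3 - f_2\circ_2\lambda_2 + f_2\circ_1\lambda_2 + (f_2\circ_2\lambda_2)^{(12)} - \lambda'_3\circ(f_1,f_1,f_1) - \lambda'_2\circ(f_1,f_2) + \lambda'_2\circ(f_2,f_1) + \lambda'_2\circ(f_1,f_2)^{(12)},$$ $$f_1\circ\lambda_4 - \lambda'_4\circ(f_1,f_1,f_1,f_1) = f_2\circ_1\lambda_3 + f_2\circ_2\lambda_3 - (f_2\circ_2\lambda_3)^{(12)} + (f_2\circ_2\lambda_3)^{(123)} - f_3\circ_1\lambda_2 + f_3\circ_2\lambda_2 - (f_3\circ_2\lambda_2)^{(12)} - f_3\circ_3\lambda_2 + (f_3\circ_3\lambda_2)^{(23)}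 - (f_3\circ_3\lambda_2)^{(132)} + \lambda'_2\circ(f_3,f_1) + \lambda'_2\circ(f_1,f_3) - \lambda'_2\circ(f_1,f_3)^{(12)} + \lambda'_2\circ(f_1,f_3)^{(123)} - \lambda'_2\circ(f_2,f_2) + \lambda'_2\circ(f_2,f_2)^{(23)} - \lambda'_2\circ(f_2,f_2)^{(132)} + \lambda'_3\circ(f_2,f_1,f_1) - \lambda'_3\circ(f_1,f_2,f_1) + \lambda'_3\circ(f_1,f_2,f_1)^{(12)} + \lambda'_3\circ(f_1,f_1,f_2) - \lambda'_3\circ(f_1,f_1,f_2)^{(23)} + \lambda'_3\circ(f_1,f_1,f_2)^{(132)},$$ and $$\partial f_{2;1}=-f_2-f_2^{(12)}+f_1\circ\lambda_{2;1}-\lambda'_{2;1}\circ(f_1,f_1),\qquad f_1\circ\lambda_{2;1,1}-\lambda'_{2;1,1}\circ(f_1,f_1)=f_{2;1}-f_{2;1}^{(12)},$$ $$f_1\circ\lambda_{3;1}-\lambda'_{3;1}\circ(f_1,f_1,f_1)=f_3+f_3^{(12)}+f_2\circ_1\lambda_{2;1}+\lambda'_2\circ(f_{2;1},f_1),$$ $$\begin{aligned}f_1\circ\lambda_{3;2}-\lambda'_{3;2}\circ(f_1,f_1,f_1)={}&f_3+f_3^{(23)}-f_2\circ_2\lambda_{2;1}+f_{2;1}\circ_1\lambda_2+(f_{2;1}\circ_2\lambda_2)^{(12)}\\&-\lambda'_2\circ(f_1,f_{2;1})-\lambda'_{2;1}\circ(f_2,f_1)-\lambda'_{2;1}\circ(f_1,f_2)^{(12)}.\end{aligned}$$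 The composition has components $(g\circ f)_1=g_1\circ f_1$, $(g\circ f)_2=g_2\circ(f_1,f_1)+g_1\circ f_2$, $(g\circ f)_{2;1}=g_{2;1}\circ(f_1,f_1)+g_1\circ f_{2;1}$ and $(g\circ f)_3=g_3\circ(f_1,f_1,f_1)-g_2\circ(f_2,f_1)+g_2\circ(f_1,f_2)-g_2\circ(f_1,f_2)^{(12)}+g_1\circ f_3$; the identity has $f_1=\mathrm{id}$ and all other components $0$. Then: (1) The maps $\lambda_2(\alpha,\beta)=\iota(v_\alpha,v_\beta)\omega$, $\lambda_3(\alpha,\beta,\gamma)=-\iota(v_\alpha,v_\beta,v_\gamma)\omega$, $\lambda_4(\alpha,\beta,\gamma,\eta)=-\iota(v_\alpha,v_\beta,v_\gamma,v_\eta)\omega$ and $\lambda_{2;1}=\lambda_{2;1,1}=\lambda_{3;1}=\lambda_{3;2}=0$ form a weak Lie 3-algebra structure on $L$, denoted $L_\infty(M,\omega)$. (2) The maps $\lambda'_2(\alpha,\beta)=\mathcal L(v_\alpha)\beta$, $\lambda'_{2;1}(\alpha,\beta)=\iota(v_\alpha)\beta+\iota(v_\beta)\alpha$ and $\lambda'_{2;1,1}=\lambda'_3=\lambda'_{3;1}=\lambda'_{3;2}=\lambda'_4=0$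 form a weak Lie 3-algebra structure on $L$, denoted $\mathrm{Leib}(M,\omega)$. (For instance, $\lambda'_{2;1}(\alpha,\beta)$ is a 1-form for $\alpha,\beta\in\Omega^2_{\mathrm{Ham}}(M)$ and a function if one of the two is a 1-form.) (3) $f_1=\mathrm{id}$, $f_2(\alpha,\beta)=-\iota(v_\alpha)\beta$, $f_{2;1}=0$, $f_3(\alpha,\beta,\gamma)=-\iota(v_\alpha,v_\beta)\gamma$ define a weak morphism $f\colon L_\infty(M,\omega)\to\mathrm{Leib}(M,\omega)$ of weak Lie 3-algebras, and $f$ is an isomorphism: there is a weak morphism $g\colon\mathrm{Leib}(M,\omega)\to L_\infty(M,\omega)$ with $g\circ f=\mathrm{id}$ and $f\circ g=\mathrm{id}$. -/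

import Mathlib

noncomputable section

namespace ThreePlectic

universe u v

/-! ## Graded multilinear maps on three-term complexes -/

/-- A three-term chain complex `L₀ ← L₁ ← L₂` of `R`-modules. -/
structure ThreeTermComplex (R : Type u) [CommRing R] where
  L0 : Type v
  L1 : Type v
  L2 : Type v
  [addCommGroup0 : AddCommGroup L0]
  [addCommGroup1 : AddCommGroup L1]
  [addCommGroup2 : AddCommGroup L2]
  [module0 : Module R L0]
  [module1 : Module R L1]
  [module2 : Module R L2]
  d1 : L1 →ₗ[R] L0
  d2 : L2 →ₗ[R] L1
  d1_comp_d2 : d1 ∘ₗ d2 = 0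

namespace ThreeTermComplex

attribute [instance] addCommGroup0 addCommGroup1 addCommGroup2 module0 module1 module2

variable {R : Type u} [CommRing R]

/-- The total module `L₀ ⊕ L₁ ⊕ L₂`. -/
abbrev Tot (C : ThreeTermComplex.{u, v} R) : Type v := C.L0 × C.L1 × C.L2

/-- The differential on the total module. -/
def d (C : ThreeTermComplex.{u, v} R) : C.Tot →ₗ[R] C.Tot where
  toFun x := (C.d1 x.2.1, C.d2 x.2.2, 0)
  map_add' x y := by simp
  map_smul' c x := by simp

/-- The homogeneous elements of degree `i` of the total module (only `0` unless `i = 0, 1, 2`). -/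
def gr (C : ThreeTermComplex.{u, v} R) (i : ℤ) : Submodule R C.Tot where
  carrier := {x | (i ≠ 0 → x.1 = 0) ∧ (i ≠ 1 → x.2.1 = 0) ∧ (i ≠ 2 → x.2.2 = 0)}
  add_mem' := by
    rintro x y ⟨hx0, hx1, hx2⟩ ⟨hy0, hy1, hy2⟩
    exact ⟨fun h => by simp [hx0 h, hy0 h], fun h => by simp [hx1 h, hy1 h],
      fun h => by simp [hx2 h, hy2 h]⟩
  zero_mem' := by simp
  smul_mem' := by
    rintro c x ⟨hx0, hx1, hx2⟩
    exact ⟨fun h => by simp [hx0 h], fun h => by simp [hx1 h], fun h => by simp [hx2 h]⟩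

end ThreeTermComplex

section Operations

variable {R : Type u} [CommRing R]

/-- A multilinear map `L^{⊗n} → L'` that is homogeneous of degree `p`. -/
structure GMap (C D : ThreeTermComplex.{u, v} R) (p : ℤ) (n : ℕ) where
  toMap : MultilinearMap R (fun _ : Fin n => C.Tot) D.Tot
  mem_gr : ∀ (e : Fin n → ℤ) (x : Fin n → C.Tot), (∀ i, x i ∈ C.gr (e i)) →
    toMap x ∈ D.gr (p + ∑ i, e i)

/-- An operation of degree `p` and arity `n`, recorded through its values on tuples of
homogeneous elements. An argument is a pair of a degree and an element, and only the values where
every element has the degree that it is paired with are ever used, see `Op.Eq`. -/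
abbrev Op (C D : ThreeTermComplex.{u, v} R) (_p : ℤ) (n : ℕ) : Type v :=
  (Fin n → ℤ × C.Tot) → D.Tot

variable {C D F : ThreeTermComplex.{u, v} R} {p q r s : ℤ} {n m k l : ℕ}

/-- Two operations agree on all tuples of homogeneous elements. -/
def Op.Eq (f g : Op C D p n) : Prop :=
  ∀ x : Fin n → ℤ × C.Tot, (∀ i, (x i).2 ∈ C.gr (x i).1) → f x = g x

notation:50 f " ≐ " g:51 => Op.Eq f g

/-- The operation given by a graded multilinear map. -/
def GMap.op (f : GMap C D p n) : Op C D p n := fun x => f.toMap fun i => (x i).2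

/-- The value of `f` on a tuple of homogeneous elements, paired with its degree. -/
def GMap.val (f : GMap C D p n) (x : Fin n → ℤ × C.Tot) : ℤ × D.Tot :=
  (p + ∑ i, (x i).1, f.op x)

/-- The differential `∂ f = d ∘ f - (-1)^|f| f ∘ d` of the complex of multilinear maps, where `d`
acts on tensors by the Leibniz rule with Koszul signs. -/
def GMap.bd (f : GMap C D p n) : Op C D (p - 1) n := fun x =>
  D.d (f.op x) - p.negOnePow • ∑ i, (∑ j ∈ Finset.univ.filter (· < i), (x j).1).negOnePow •
    f.op (Function.update x i ((x i).1 - 1, C.d (x i).2))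

/-- The partial composition of `f` with `g` inserted in the slot `i` (counted from `0`), with the
Koszul sign for moving `g` past the arguments to its left. -/
def GMap.circ (f : GMap C D p (m + 1)) (i : Fin (m + 1)) (g : GMap C C q n) :
    Op C D (p + q) (m + n) := fun x =>
  (q * ∑ j : Fin i, (x ⟨j, by omega⟩).1).negOnePow • f.op fun j =>
    if h : j < i then x ⟨j, by omega⟩
    else if h' : j = i then g.val fun t : Fin n => x ⟨i + t, by omega⟩
    else x ⟨j + n - 1, by omega⟩

/-- `h ∘ (g, …, g)` for `g` unary of degree `0`. -/
def GMap.compDiag (h : GMap D F p n) (g : GMap C D 0 1) : Op C F p n := fun x =>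
  h.op fun i => g.val ![x i]

/-- The composition `h ∘ g` with `h` unary. -/
def GMap.comp1 (h : GMap D F p 1) (g : GMap C D q n) : Op C F (p + q) n := fun x =>
  h.op ![g.val x]

/-- The composition `h ∘ (g₁, g₂)`, with Koszul signs. -/
def GMap.comp2 (h : GMap D F p 2) (g₁ : GMap C D q m) (g₂ : GMap C D r n) :
    Op C F (p + q + r) (m + n) := fun x =>
  (r * ∑ i : Fin m, (x (i.castAdd n)).1).negOnePow •
    h.op ![g₁.val fun i => x (i.castAdd n), g₂.val fun i => x (i.natAdd m)]

/-- The composition `h ∘ (g₁, g₂, g₃)`, with Koszul signs. -/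
def GMap.comp3 (h : GMap D F p 3) (g₁ : GMap C D q m) (g₂ : GMap C D r n) (g₃ : GMap C D s k) :
    Op C F (p + q + r + s) (m + n + k) := fun x =>
  (r * ∑ i : Fin m, (x ((i.castAdd n).castAdd k)).1 +
      s * ∑ i : Fin (m + n), (x (i.castAdd k)).1).negOnePow •
    h.op ![g₁.val fun i => x ((i.castAdd n).castAdd k), g₂.val fun i => x ((i.natAdd m).castAdd k),
      g₃.val fun i => x (i.natAdd (m + n))]

/-- The Koszul sign of moving the `i`-th of `n` homogeneous elements of degrees `e` to the
position `σ i`, for all `i`. -/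
def koszulSign (σ : Equiv.Perm (Fin n)) (e : Fin n → ℤ) : ℤˣ :=
  ∏ i, ∏ j, if i < j ∧ σ j < σ i then (e i * e j).negOnePow else 1

/-- The right action of permutations on operations:
`f^σ (x₁, …, xₙ) = ± f (x_{σ⁻¹(1)}, …, x_{σ⁻¹(n)})` with the Koszul sign. -/
def Op.act (f : Op C D p n) (σ : Equiv.Perm (Fin n)) : Op C D p n := fun x =>
  koszulSign σ (fun i => (x i).1) • f fun i => x (σ⁻¹ i)

/-- The cyclic permutation `a₁ ↦ a₂ ↦ ⋯ ↦ aₖ ↦ a₁` (as usual, but with entries counted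
from `0`). -/
def cyc (a : List (Fin n)) : Equiv.Perm (Fin n) := a.formPerm

end Operations

/-! ## Weak Lie 3-algebras -/

section WeakLie

variable {R : Type u} [CommRing R]

/-- A weak Lie 3-algebra structure on a three-term complex. -/
structure WeakLie3Algebra (C : ThreeTermComplex.{u, v} R) where
  l2 : GMap C C 0 2
  l21 : GMap C C 1 2
  l211 : GMap C C 2 2
  l3 : GMap C C 1 3
  l31 : GMap C C 2 3
  l32 : GMap C C 2 3
  l4 : GMap C C 2 4
  -- the underlying Leibniz 3-algebra
  leib2 : l2.bd ≐ 0
  leib3 : l3.bd ≐ l2.circ 1 l2 - l2.circ 0 l2 - (l2.circ 1 l2).act (cyc [0, 1])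
  leib4 : l4.bd ≐
    l2.circ 0 l3 + l2.circ 1 l3 - (l2.circ 1 l3).act (cyc [0, 1])
    + (l2.circ 1 l3).act (cyc [0, 1, 2]) - l3.circ 0 l2
    + l3.circ 1 l2 - (l3.circ 1 l2).act (cyc [0, 1])
    - l3.circ 2 l2 + (l3.circ 2 l2).act (cyc [1, 2])
    - (l3.circ 2 l2).act (cyc [0, 2, 1])
  leib5 : 0 ≐
    l2.circ 0 l4 - l2.circ 1 l4
    + (l2.circ 1 l4).act (cyc [0, 1])
    - (l2.circ 1 l4).act (cyc [0, 1, 2]) + (l2.circ 1 l4).act (cyc [0, 1, 2, 3])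
    + l3.circ 0 l3 + l3.circ 1 l3
    - (l3.circ 1 l3).act (cyc [0, 1])
    + (l3.circ 1 l3).act (cyc [0, 1, 2]) + l3.circ 2 l3
    - (l3.circ 2 l3).act (cyc [1, 2]) + (l3.circ 2 l3).act (cyc [0, 2, 1])
    + (l3.circ 2 l3).act (cyc [1, 2, 3]) - (l3.circ 2 l3).act (cyc [0, 2, 3, 1])
    + (l3.circ 2 l3).act (cyc [0, 2] * cyc [1, 3])
    + l4.circ 0 l2 - l4.circ 1 l2
    + (l4.circ 1 l2).act (cyc [0, 1])
    + l4.circ 2 l2 - (l4.circ 2 l2).act (cyc [1, 2])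
    + (l4.circ 2 l2).act (cyc [0, 2, 1]) - l4.circ 3 l2
    + (l4.circ 3 l2).act (cyc [2, 3]) - (l4.circ 3 l2).act (cyc [1, 3, 2])
    + (l4.circ 3 l2).act (cyc [0, 3, 2, 1])
  -- the symmetry up to homotopy
  bd_l21 : l21.bd ≐ l2.op + l2.op.act (cyc [0, 1])
  bd_l211 : l211.bd ≐ l21.op - l21.op.act (cyc [0, 1])
  bd_l31 : l31.bd ≐ l3.op + l3.op.act (cyc [0, 1]) + l2.circ 0 l21
  bd_l32 : l32.bd ≐
    l3.op + l3.op.act (cyc [1, 2]) - l2.circ 1 l21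
    + l21.circ 0 l2 + (l21.circ 1 l2).act (cyc [0, 1])
  sym_l211 : l211.op + l211.op.act (cyc [0, 1]) ≐ 0
  sym_l31 : l31.op - l31.op.act (cyc [0, 1]) ≐ l2.circ 0 l211
  sym_l31_l32 :
    l31.op - l32.op.act (cyc [0, 1]) + l31.op.act (cyc [0, 2, 1])
    - l32.op + l31.op.act (cyc [1, 2]) - l32.op.act (cyc [0, 1, 2]) ≐
    l21.circ 1 l21 + l21.circ 0 l21
    + (l21.circ 1 l21).act (cyc [0, 1]) + (l211.circ 1 l2).act (cyc [0, 2, 1])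
  sym_l32 : l32.op - l32.op.act (cyc [1, 2]) ≐
    - l2.circ 1 l211 + l211.circ 0 l2 + (l211.circ 1 l2).act (cyc [0, 1])
  sym_l4_12 : l4.op + l4.op.act (cyc [0, 1]) ≐
    l2.circ 0 l31 - l31.circ 2 l2
    + (l2.circ 1 l31).act (cyc [0, 1, 2]) + l3.circ 0 l21
  sym_l4_23 : l4.op + l4.op.act (cyc [1, 2]) ≐
    l2.circ 0 l32 - l3.circ 1 l21 + l2.circ 1 l31
    - l31.circ 0 l2 - (l31.circ 1 l2).act (cyc [0, 1])
    - (l31.circ 2 l2).act (cyc [0, 2, 1])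
  sym_l4_34 : l4.op + l4.op.act (cyc [2, 3]) ≐
    l21.circ 0 l3 - l32.circ 0 l2
    + l32.circ 1 l2 - (l32.circ 1 l2).act (cyc [0, 1])
    + l3.circ 2 l21
    + (l32.circ 2 l2).act (cyc [1, 2]) - (l32.circ 2 l2).act (cyc [0, 2, 1])
    + l2.circ 1 l32 - (l2.circ 1 l32).act (cyc [0, 1])
    + (l21.circ 1 l3).act (cyc [0, 1, 2])

variable {C D : ThreeTermComplex.{u, v} R}

/-- A weak morphism of weak Lie 3-algebras. -/
structure WeakMorphism (A : WeakLie3Algebra C) (B : WeakLie3Algebra D) where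
  f1 : GMap C D 0 1
  f2 : GMap C D 1 2
  f21 : GMap C D 2 2
  f3 : GMap C D 2 3
  -- the underlying weak morphism of Leibniz 3-algebras
  leib1 : f1.bd ≐ 0
  leib2 : f2.bd ≐ f1.comp1 A.l2 - B.l2.compDiag f1
  leib3 : f3.bd ≐
    f1.comp1 A.l3
    - f2.circ 1 A.l2 + f2.circ 0 A.l2 + (f2.circ 1 A.l2).act (cyc [0, 1])
    - B.l3.compDiag f1
    - B.l2.comp2 f1 f2 + B.l2.comp2 f2 f1 + (B.l2.comp2 f1 f2).act (cyc [0, 1])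
  leib4 : f1.comp1 A.l4 - B.l4.compDiag f1 ≐
    f2.circ 0 A.l3 + f2.circ 1 A.l3 - (f2.circ 1 A.l3).act (cyc [0, 1])
    + (f2.circ 1 A.l3).act (cyc [0, 1, 2]) - f3.circ 0 A.l2
    + f3.circ 1 A.l2 - (f3.circ 1 A.l2).act (cyc [0, 1]) - f3.circ 2 A.l2
    + (f3.circ 2 A.l2).act (cyc [1, 2]) - (f3.circ 2 A.l2).act (cyc [0, 2, 1])
    + B.l2.comp2 f3 f1 + B.l2.comp2 f1 f3 - (B.l2.comp2 f1 f3).act (cyc [0, 1])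
    + (B.l2.comp2 f1 f3).act (cyc [0, 1, 2])
    - B.l2.comp2 f2 f2 + (B.l2.comp2 f2 f2).act (cyc [1, 2])
    - (B.l2.comp2 f2 f2).act (cyc [0, 2, 1])
    + B.l3.comp3 f2 f1 f1
    - B.l3.comp3 f1 f2 f1 + (B.l3.comp3 f1 f2 f1).act (cyc [0, 1])
    + B.l3.comp3 f1 f1 f2
    - (B.l3.comp3 f1 f1 f2).act (cyc [1, 2]) + (B.l3.comp3 f1 f1 f2).act (cyc [0, 2, 1])
  -- the compatibility with the symmetry up to homotopy
  bd_f21 : f21.bd ≐ - f2.op - f2.op.act (cyc [0, 1]) + f1.comp1 A.l21 - B.l21.compDiag f1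
  sym_l211 : f1.comp1 A.l211 - B.l211.compDiag f1 ≐ f21.op - f21.op.act (cyc [0, 1])
  sym_l31 : f1.comp1 A.l31 - B.l31.compDiag f1 ≐
    f3.op + f3.op.act (cyc [0, 1]) + f2.circ 0 A.l21 + B.l2.comp2 f21 f1
  sym_l32 : f1.comp1 A.l32 - B.l32.compDiag f1 ≐
    f3.op + f3.op.act (cyc [1, 2]) - f2.circ 1 A.l21
    + f21.circ 0 A.l2 + (f21.circ 1 A.l2).act (cyc [0, 1])
    - B.l2.comp2 f1 f21 - B.l21.comp2 f2 f1
    - (B.l21.comp2 f1 f2).act (cyc [0, 1])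

/-- The composition `g ∘ f` of weak morphisms is the identity, that is, its components are
`(g ∘ f)₁ = id` and `(g ∘ f)₂ = 0`, `(g ∘ f)_{2;1} = 0`, `(g ∘ f)₃ = 0`. -/
structure WeakMorphism.CompEqId {A : WeakLie3Algebra C} {B : WeakLie3Algebra D}
    (g : WeakMorphism B A) (f : WeakMorphism A B) : Prop where
  comp1 : g.f1.compDiag f.f1 ≐ fun x => (x 0).2
  comp2 : g.f2.compDiag f.f1 + g.f1.comp1 f.f2 ≐ 0
  comp21 : g.f21.compDiag f.f1 + g.f1.comp1 f.f21 ≐ 0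
  comp3 : g.f3.compDiag f.f1 - g.f2.comp2 f.f2 f.f1 + g.f2.comp2 f.f1 f.f2
    - (g.f2.comp2 f.f1 f.f2).act (cyc [0, 1]) + g.f1.comp1 f.f3 ≐ 0

/-- A weak morphism is an isomorphism if it has a two-sided inverse weak morphism. -/
def WeakMorphism.IsIso {A : WeakLie3Algebra C} {B : WeakLie3Algebra D}
    (f : WeakMorphism A B) : Prop :=
  ∃ g : WeakMorphism B A, g.CompEqId f ∧ f.CompEqId g

end WeakLie

/-! ## Differential forms on manifolds -/

section Geometry

open scoped Manifold ContDiff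

variable {E : Type u} [NormedAddCommGroup E] [NormedSpace ℝ E]
  {M : Type v} [TopologicalSpace M] [ChartedSpace E M]

/-- Not necessarily smooth differential `k`-forms on `M`. -/
abbrev PreForm (E : Type u) [NormedAddCommGroup E] [NormedSpace ℝ E] (M : Type v)
    [TopologicalSpace M] [ChartedSpace E M] (k : ℕ) : Type (max u v) :=
  ∀ x : M, TangentSpace 𝓘(ℝ, E) x [⋀^Fin k]→L[ℝ] ℝ

/-- The pullback of a form along the inverse of the preferred chart at `a`; only its values on the
target of the chart matter. -/
def localForm {k : ℕ} (a : M) (α : PreForm E M k) (y : E) : E [⋀^Fin k]→L[ℝ] ℝ :=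
  (α ((extChartAt 𝓘(ℝ, E) a).symm y)).compContinuousLinearMap
    (mfderiv 𝓘(ℝ, E) 𝓘(ℝ, E) (extChartAt 𝓘(ℝ, E) a).symm y)

/-- The exterior derivative, computed at each point in the preferred chart there. -/
def extD {k : ℕ} (α : PreForm E M k) : PreForm E M (k + 1) := fun x =>
  (extDeriv (localForm x α) (extChartAt 𝓘(ℝ, E) x x)).compContinuousLinearMap
    (mfderiv 𝓘(ℝ, E) 𝓘(ℝ, E) (extChartAt 𝓘(ℝ, E) x) x)

/-- A form is smooth if its expressions in the charts are. -/
def IsSmooth {k : ℕ} (α : PreForm E M k) : Prop :=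
  ∀ a : M, ContDiffOn ℝ ∞ (localForm a α) (extChartAt 𝓘(ℝ, E) a).target

theorem two_le : minSmoothness ℝ 2 ≤ ∞ := by
  rw [minSmoothness_of_isRCLikeNormedField]
  exact WithTop.coe_le_coe.2 (le_top : (2 : ℕ∞) ≤ ⊤)

theorem localForm_add {k : ℕ} (a : M) (α β : PreForm E M k) :
    localForm a (α + β) = localForm a α + localForm a β := rfl

theorem localForm_smul {k : ℕ} (a : M) (c : ℝ) (α : PreForm E M k) :
    localForm a (c • α) = c • localForm a α := rfl

theorem localForm_contDiffAt {k : ℕ} {α : PreForm E M k} (hα : IsSmooth α) (a : M) {y : E}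
    (hy : y ∈ (extChartAt 𝓘(ℝ, E) a).target) : ContDiffAt ℝ ∞ (localForm a α) y :=
  (hα a).contDiffAt ((isOpen_extChartAt_target a).mem_nhds hy)

theorem extD_smul {k : ℕ} (c : ℝ) (α : PreForm E M k) : extD (c • α) = c • extD α := by
  funext x
  have h : extDeriv (localForm x (c • α)) (extChartAt 𝓘(ℝ, E) x x) = _ :=
    extDeriv_smul c (localForm x α)
  change ContinuousAlternatingMap.compContinuousLinearMap _ _ = _
  rw [h]
  rfl

theorem extD_add {k : ℕ} {α β : PreForm E M k} (hα : IsSmooth α) (hβ : IsSmooth β) :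
    extD (α + β) = extD α + extD β := by
  funext x
  have hx := mem_extChartAt_target (I := 𝓘(ℝ, E)) x
  have h : extDeriv (localForm x (α + β)) (extChartAt 𝓘(ℝ, E) x x) = _ :=
    extDeriv_add ((localForm_contDiffAt hα x hx).differentiableAt (by simp))
      ((localForm_contDiffAt hβ x hx).differentiableAt (by simp))
  change ContinuousAlternatingMap.compContinuousLinearMap _ _ = _
  rw [h]
  rfl


theorem isSmooth_zero {k : ℕ} : IsSmooth (0 : PreForm E M k) := fun _ =>
  contDiffOn_const (c := (0 : E [⋀^Fin k]→L[ℝ] ℝ))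

variable (E M) in
/-- The smooth differential `k`-forms, as a submodule. -/
def smoothForms (k : ℕ) : Submodule ℝ (PreForm E M k) where
  carrier := {α | IsSmooth α}
  add_mem' hα hβ a := (hα a).add (hβ a)
  zero_mem' := isSmooth_zero
  smul_mem' c _ hα a := (hα a).const_smul c

variable (E M) in
/-- The space `Ω^k(M)` of smooth differential `k`-forms. -/
def Form (k : ℕ) : Type (max u v) := smoothForms E M k

instance (k : ℕ) : AddCommGroup (Form E M k) := Submodule.addCommGroup _

instance (k : ℕ) : Module ℝ (Form E M k) := Submodule.module _

/-- The contraction `ι(v)α = α(v, ⋅, …, ⋅)`. -/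
def contract {k : ℕ} (v : ∀ x : M, TangentSpace 𝓘(ℝ, E) x) (α : PreForm E M (k + 1)) :
    PreForm E M k := fun x =>
  ContinuousAlternatingMap.curryLeft (E := E) (α x) (v x)

/-- The expression of a vector field in the preferred chart at `a`. -/
def localField (a : M) (v : ∀ x : M, TangentSpace 𝓘(ℝ, E) x) (y : E) : E :=
  mfderiv 𝓘(ℝ, E) 𝓘(ℝ, E) (extChartAt 𝓘(ℝ, E) a) ((extChartAt 𝓘(ℝ, E) a).symm y)
    (v ((extChartAt 𝓘(ℝ, E) a).symm y))

/-- The Lie derivative of a form along a vector field, evaluated at `x` on tangent vectors `u`.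
In a chart it is `∑ⱼ vʲ ∂ⱼ α (u₁, …, uₖ) + ∑ᵢ α (u₁, …, Dv(uᵢ), …, uₖ)`. -/
def lieDeriv {k : ℕ} (v : ∀ x : M, TangentSpace 𝓘(ℝ, E) x) (α : PreForm E M k) (x : M)
    (u : Fin k → TangentSpace 𝓘(ℝ, E) x) : ℝ :=
  let y : E := extChartAt 𝓘(ℝ, E) x x
  let w : Fin k → E := fun i => mfderiv 𝓘(ℝ, E) 𝓘(ℝ, E) (extChartAt 𝓘(ℝ, E) x) x (u i)
  fderiv ℝ (localForm x α) y (localField x v y) w +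
    ∑ i, localForm x α y (Function.update w i (fderiv ℝ (localField x v) y (w i)))

variable [IsManifold 𝓘(ℝ, E) ∞ M]

theorem mdiff_symm (a : M) {y : E} (hy : y ∈ (extChartAt 𝓘(ℝ, E) a).target) :
    MDifferentiableAt 𝓘(ℝ, E) 𝓘(ℝ, E) (extChartAt 𝓘(ℝ, E) a).symm y :=
  ((contMDiffOn_extChartAt_symm (n := ∞) a).mdifferentiableOn (by simp)).mdifferentiableAt
    ((isOpen_extChartAt_target a).mem_nhds hy)

theorem mdiff_chart (a : M) {x : M} (hx : x ∈ (extChartAt 𝓘(ℝ, E) a).source) :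
    MDifferentiableAt 𝓘(ℝ, E) 𝓘(ℝ, E) (extChartAt 𝓘(ℝ, E) a) x :=
  ((contMDiffOn_extChartAt (n := ∞) (x := a)).mdifferentiableOn (by simp)).mdifferentiableAt
    (by rw [← extChartAt_source 𝓘(ℝ, E)]; exact (isOpen_extChartAt_source a).mem_nhds hx)

/-- Independence of the chart: local expressions of a form are related by pullback along the
transition maps. -/
theorem localForm_change {k : ℕ} (α : PreForm E M k) (a b : M) {y : E}
    (hy : y ∈ (extChartAt 𝓘(ℝ, E) a).target)
    (hb : (extChartAt 𝓘(ℝ, E) a).symm y ∈ (extChartAt 𝓘(ℝ, E) b).source) :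
    localForm a α y =
      (localForm b α
        (extChartAt 𝓘(ℝ, E) b ((extChartAt 𝓘(ℝ, E) a).symm y))).compContinuousLinearMap
      (fderiv ℝ (extChartAt 𝓘(ℝ, E) b ∘ (extChartAt 𝓘(ℝ, E) a).symm) y) := by
  set f : E → M := ⇑(extChartAt 𝓘(ℝ, E) a).symm with hf
  set h : M → E := ⇑(extChartAt 𝓘(ℝ, E) b) with hh
  set g : E → M := ⇑(extChartAt 𝓘(ℝ, E) b).symm with hg
  have hfy : MDifferentiableAt 𝓘(ℝ, E) 𝓘(ℝ, E) f y := mdiff_symm a hy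
  have hhy : MDifferentiableAt 𝓘(ℝ, E) 𝓘(ℝ, E) h (f y) := mdiff_chart b hb
  have hgy : MDifferentiableAt 𝓘(ℝ, E) 𝓘(ℝ, E) g ((h ∘ f) y) :=
    mdiff_symm b ((extChartAt 𝓘(ℝ, E) b).map_source hb)
  have hev : f =ᶠ[nhds y] g ∘ (h ∘ f) := by
    have hc : ContinuousAt f y := hfy.continuousAt
    filter_upwards [hc.preimage_mem_nhds ((isOpen_extChartAt_source b).mem_nhds hb)] with z hz
    exact ((extChartAt 𝓘(ℝ, E) b).left_inv hz).symm
  have h1 : mfderiv 𝓘(ℝ, E) 𝓘(ℝ, E) f y = (mfderiv 𝓘(ℝ, E) 𝓘(ℝ, E) g ((h ∘ f) y)).comp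
      (mfderiv 𝓘(ℝ, E) 𝓘(ℝ, E) (h ∘ f) y) :=
    hev.mfderiv_eq.trans (mfderiv_comp y hgy (hhy.comp y hfy))
  have h2 : f y = g ((h ∘ f) y) := hev.eq_of_nhds
  rw [mfderiv_eq_fderiv] at h1
  let G : M → (E →L[ℝ] E) → E [⋀^Fin k]→L[ℝ] ℝ := fun p L =>
    ContinuousAlternatingMap.compContinuousLinearMap (M := E) (M' := E) (α p) L
  change G (f y) (mfderiv 𝓘(ℝ, E) 𝓘(ℝ, E) f y) =
    (G (g ((h ∘ f) y)) (mfderiv 𝓘(ℝ, E) 𝓘(ℝ, E) g ((h ∘ f) y))).compContinuousLinearMap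
      (fderiv ℝ (h ∘ f) y)
  exact (congrArg₂ G h2 h1).trans rfl

theorem transition_contDiffAt (a b : M) {y : E}
    (hy : y ∈ (extChartAt 𝓘(ℝ, E) a).target)
    (hb : (extChartAt 𝓘(ℝ, E) a).symm y ∈ (extChartAt 𝓘(ℝ, E) b).source) :
    ContDiffAt ℝ ∞ (extChartAt 𝓘(ℝ, E) b ∘ (extChartAt 𝓘(ℝ, E) a).symm) y := by
  rw [← contMDiffAt_iff_contDiffAt]
  refine ContMDiffAt.comp y ?_ ((contMDiffOn_extChartAt_symm (n := ∞) a).contMDiffAt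
    ((isOpen_extChartAt_target a).mem_nhds hy))
  exact contMDiffAt_extChartAt' (by rwa [extChartAt_source] at hb)

/-- The exterior derivative may be computed in any chart. -/
theorem localForm_extD {k : ℕ} {α : PreForm E M k} (hα : IsSmooth α) (a : M) {y : E}
    (hy : y ∈ (extChartAt 𝓘(ℝ, E) a).target) :
    localForm a (extD α) y = extDeriv (localForm a α) y := by
  set f : E → M := ⇑(extChartAt 𝓘(ℝ, E) a).symm with hf
  set b : M := f y with hbdef
  have hb : f y ∈ (extChartAt 𝓘(ℝ, E) b).source := mem_extChartAt_source b
  have hfy : MDifferentiableAt 𝓘(ℝ, E) 𝓘(ℝ, E) f y := mdiff_symm a hy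
  have hhy : MDifferentiableAt 𝓘(ℝ, E) 𝓘(ℝ, E) (extChartAt 𝓘(ℝ, E) b) (f y) := mdiff_chart b hb
  have h1 : localForm a (extD α) y =
      (extDeriv (localForm b α) (extChartAt 𝓘(ℝ, E) b (f y))).compContinuousLinearMap
        (fderiv ℝ (extChartAt 𝓘(ℝ, E) b ∘ f) y) := by
    have h2 := mfderiv_comp y hhy hfy
    rw [mfderiv_eq_fderiv] at h2
    rw [h2]
    rfl
  have h3 : localForm a α =ᶠ[nhds y] fun z =>
      (localForm b α ((extChartAt 𝓘(ℝ, E) b ∘ f) z)).compContinuousLinearMap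
        (fderiv ℝ (extChartAt 𝓘(ℝ, E) b ∘ f) z) := by
    filter_upwards [(isOpen_extChartAt_target a).mem_nhds hy,
      hfy.continuousAt.preimage_mem_nhds ((isOpen_extChartAt_source b).mem_nhds hb)] with z hz hz'
    exact localForm_change α a b hz hz'
  rw [h1, h3.extDeriv_eq]
  exact (extDeriv_pullback (r := ∞) (f := extChartAt 𝓘(ℝ, E) b ∘ f)
    ((localForm_contDiffAt hα b ((extChartAt 𝓘(ℝ, E) b).map_source hb)).differentiableAt (by simp))
    (transition_contDiffAt a b hy hb) two_le).symm

theorem IsSmooth.extD {k : ℕ} {α : PreForm E M k} (hα : IsSmooth α) : IsSmooth (extD α) := by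
  intro a
  have h : ContDiffOn ℝ ∞ (fun y => ContinuousAlternatingMap.alternatizeUncurryFinCLM ℝ E ℝ
      (fderiv ℝ (localForm a α) y)) (extChartAt 𝓘(ℝ, E) a).target :=
    (ContinuousLinearMap.contDiff _).comp_contDiffOn
      ((hα a).fderiv_of_isOpen (isOpen_extChartAt_target a) (by simp))
  exact h.congr fun y hy => localForm_extD hα a hy

theorem extD_extD {k : ℕ} {α : PreForm E M k} (hα : IsSmooth α) : extD (extD α) = 0 := by
  funext x
  have hx := mem_extChartAt_target (I := 𝓘(ℝ, E)) x
  have h : localForm x (ThreePlectic.extD α) =ᶠ[nhds (extChartAt 𝓘(ℝ, E) x x)]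
      extDeriv (localForm x α) := by
    filter_upwards [(isOpen_extChartAt_target x).mem_nhds hx] with z hz
    exact localForm_extD hα x hz
  have h0 : extDeriv (localForm x (ThreePlectic.extD α)) (extChartAt 𝓘(ℝ, E) x x) = 0 := by
    rw [h.extDeriv_eq]
    exact extDeriv_extDeriv_apply (localForm_contDiffAt hα x hx) two_le
  change ContinuousAlternatingMap.compContinuousLinearMap _ _ = 0
  rw [h0]
  ext v
  rfl

/-- The de Rham differential `Ω^k(M) → Ω^{k+1}(M)`. -/
def deRham (k : ℕ) : Form E M k →ₗ[ℝ] Form E M (k + 1) where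
  toFun α := ⟨extD α.1, IsSmooth.extD α.2⟩
  map_add' α β := Subtype.ext (extD_add α.2 β.2)
  map_smul' c α := Subtype.ext (extD_smul c α.1)

theorem deRham_deRham {k : ℕ} (α : Form E M k) : deRham (k + 1) (deRham k α) = 0 :=
  Subtype.ext (extD_extD α.2)

variable (E M) in
/-- Smooth vector fields. -/
abbrev VectorField : Type (max u v) :=
  ContMDiffSection 𝓘(ℝ, E) E ∞ (TangentSpace 𝓘(ℝ, E) : M → Type u)

/-- An `n`-plectic form: a closed, non-degenerate `(n+1)`-form. -/
structure IsPlectic (n : ℕ) (ϖ : Form E M (n + 1)) : Prop where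
  closed : deRham (n + 1) ϖ = 0
  nondegenerate : ∀ (x : M) (v : TangentSpace 𝓘(ℝ, E) x),
    ContinuousAlternatingMap.curryLeft (E := E) (ϖ.1 x) v = 0 → v = 0

/-- `v` is a Hamiltonian vector field of the form `α`, that is, `dα = -ι(v)ϖ`. -/
def IsHamiltonianField {m : ℕ} (ϖ : Form E M (m + 2)) (α : Form E M m) (v : VectorField E M) :
    Prop :=
  (deRham m α).1 = -contract (fun x => v x) ϖ.1

/-- The space of Hamiltonian forms. -/
def hamiltonianForms {m : ℕ} (ϖ : Form E M (m + 2)) : Submodule ℝ (Form E M m) where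
  carrier := {α | ∃ v : VectorField E M, IsHamiltonianField ϖ α v}
  add_mem' := by
    rintro α β ⟨v, hv⟩ ⟨w, hw⟩
    refine ⟨v + w, ?_⟩
    have h : (deRham m (α + β)).1 = (deRham m α).1 + (deRham m β).1 := by rw [map_add]; rfl
    rw [IsHamiltonianField, h, hv, hw, ← neg_add]
    refine congrArg _ (funext fun x => ?_)
    exact (map_add (ContinuousAlternatingMap.curryLeft (E := E) (ϖ.1 x)) (v x) (w x)).symm
  zero_mem' := by
    refine ⟨0, ?_⟩
    have h : (deRham m (0 : Form E M m)).1 = 0 := by rw [map_zero]; rfl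
    rw [IsHamiltonianField, h, eq_comm, neg_eq_zero]
    exact funext fun x => map_zero (ContinuousAlternatingMap.curryLeft (E := E) (ϖ.1 x))
  smul_mem' := by
    rintro c α ⟨v, hv⟩
    refine ⟨c • v, ?_⟩
    have h : (deRham m (c • α)).1 = c • (deRham m α).1 := by rw [map_smul]; rfl
    rw [IsHamiltonianField, h, hv, smul_neg]
    refine congrArg _ (funext fun x => ?_)
    exact (map_smul (ContinuousAlternatingMap.curryLeft (E := E) (ϖ.1 x)) c (v x)).symm

theorem deRham_mem_hamiltonianForms {m : ℕ} (ϖ : Form E M (m + 3)) (β : Form E M m) :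
    deRham m β ∈ hamiltonianForms ϖ := by
  refine ⟨0, ?_⟩
  have h : (deRham (m + 1) (deRham m β)).1 = 0 := by rw [deRham_deRham]; rfl
  rw [IsHamiltonianField, h, eq_comm, neg_eq_zero]
  exact funext fun x => map_zero (ContinuousAlternatingMap.curryLeft (E := E) (ϖ.1 x))

open Classical in
/-- The Hamiltonian vector field `v_α` of a form `α`, which is unique for a non-degenerate `ϖ`
(and `0` if `α` is not Hamiltonian). -/
def hamiltonianField {m : ℕ} (ϖ : Form E M (m + 2)) (α : Form E M m) : VectorField E M :=
  if h : ∃ v : VectorField E M, IsHamiltonianField ϖ α v then h.choose else 0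

/-! ## The two structures on a 3-plectic manifold -/

/-- The complex `Ω²_Ham(M) ← Ω¹(M) ← Ω⁰(M)` with the de Rham differential. -/
def plecticComplex (ϖ : Form E M 4) : ThreeTermComplex.{0, max u v} ℝ where
  L0 := hamiltonianForms (m := 2) ϖ
  L1 := Form E M 1
  L2 := Form E M 0
  d1 := (deRham 1).codRestrict (hamiltonianForms (m := 2) ϖ)
    fun β => deRham_mem_hamiltonianForms (m := 1) ϖ β
  d2 := deRham 0
  d1_comp_d2 := by
    ext1 f
    exact Subtype.ext (deRham_deRham f)

namespace plecticComplex

variable {ϖ : Form E M 4}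

/-- The component of degree `0`, as a smooth 2-form. -/
def hamForm (a : (plecticComplex ϖ).Tot) : Form E M 2 :=
  Subtype.val (show hamiltonianForms (m := 2) ϖ from a.1)

/-- The component of degree `0`, a Hamiltonian 2-form. -/
def form0 (a : (plecticComplex ϖ).Tot) : PreForm E M 2 :=
  Subtype.val (hamForm a)

/-- The component of degree `1`, a 1-form. -/
def form1 (a : (plecticComplex ϖ).Tot) : PreForm E M 1 :=
  Subtype.val (show Form E M 1 from a.2.1)

/-- The component of degree `2`, a 0-form, that is, a smooth function. -/
def form2 (a : (plecticComplex ϖ).Tot) : PreForm E M 0 :=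
  Subtype.val (show Form E M 0 from a.2.2)

/-- The Hamiltonian vector field of the degree `0` component; the components of positive degree
have Hamiltonian vector field `0` by convention. -/
def field (a : (plecticComplex ϖ).Tot) (x : M) : TangentSpace 𝓘(ℝ, E) x :=
  hamiltonianField (m := 2) ϖ (hamForm a) x

end plecticComplex

open plecticComplex

/-- The weak Lie 3-algebra structure is the one of `L_∞(M, ϖ)`:
`λ₂(α, β) = ι(v_α, v_β)ϖ`, `λ₃(α, β, γ) = -ι(v_α, v_β, v_γ)ϖ`,
`λ₄(α, β, γ, η) = -ι(v_α, v_β, v_γ, v_η)ϖ`, and the remaining structure maps vanish.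
Here `ι(v₁, …, vₖ)ϖ = ι(vₖ) ⋯ ι(v₁)ϖ = ϖ(v₁, …, vₖ, ⋅)`. -/
structure IsLInfinity (ϖ : Form E M 4) (A : WeakLie3Algebra (plecticComplex ϖ)) : Prop where
  l2 : ∀ a b : (plecticComplex ϖ).Tot,
    form0 (A.l2.toMap ![a, b]) = contract (field b) (contract (field a) ϖ.1) ∧
    form1 (A.l2.toMap ![a, b]) = 0 ∧
    form2 (A.l2.toMap ![a, b]) = 0
  l3 : ∀ a b c : (plecticComplex ϖ).Tot,
    form0 (A.l3.toMap ![a, b, c]) = 0 ∧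
    form1 (A.l3.toMap ![a, b, c]) =
      -contract (field c) (contract (field b) (contract (field a) ϖ.1)) ∧
    form2 (A.l3.toMap ![a, b, c]) = 0
  l4 : ∀ a b c e : (plecticComplex ϖ).Tot,
    form0 (A.l4.toMap ![a, b, c, e]) = 0 ∧
    form1 (A.l4.toMap ![a, b, c, e]) = 0 ∧
    form2 (A.l4.toMap ![a, b, c, e]) =
      -contract (field e) (contract (field c) (contract (field b) (contract (field a) ϖ.1)))
  l21 : A.l21.toMap = 0
  l211 : A.l211.toMap = 0
  l31 : A.l31.toMap = 0
  l32 : A.l32.toMap = 0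

/-- The weak Lie 3-algebra structure is the one of the dg Leibniz algebra `Leib(M, ϖ)` with its
alternator: `λ₂(α, β)` is the Lie derivative of `β` along `v_α`,
`λ_{2;1}(α, β) = ι(v_α)β + ι(v_β)α`, and the remaining structure maps vanish. -/
structure IsLeib (ϖ : Form E M 4) (B : WeakLie3Algebra (plecticComplex ϖ)) : Prop where
  l2 : ∀ a b : (plecticComplex ϖ).Tot,
    (∀ x u, form0 (B.l2.toMap ![a, b]) x u = lieDeriv (field a) (form0 b) x u) ∧
    (∀ x u, form1 (B.l2.toMap ![a, b]) x u = lieDeriv (field a) (form1 b) x u) ∧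
    (∀ x u, form2 (B.l2.toMap ![a, b]) x u = lieDeriv (field a) (form2 b) x u)
  l21 : ∀ a b : (plecticComplex ϖ).Tot,
    form0 (B.l21.toMap ![a, b]) = 0 ∧
    form1 (B.l21.toMap ![a, b]) = contract (field a) (form0 b) + contract (field b) (form0 a) ∧
    form2 (B.l21.toMap ![a, b]) = contract (field a) (form1 b) + contract (field b) (form1 a)
  l211 : B.l211.toMap = 0
  l3 : B.l3.toMap = 0
  l31 : B.l31.toMap = 0
  l32 : B.l32.toMap = 0
  l4 : B.l4.toMap = 0

/-- The weak morphism has the components `f₁ = id`, `f₂(α, β) = -ι(v_α)β`, `f_{2;1} = 0` and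
`f₃(α, β, γ) = -ι(v_α, v_β)γ`. -/
structure IsComparison {ϖ : Form E M 4} {A B : WeakLie3Algebra (plecticComplex ϖ)}
    (f : WeakMorphism A B) : Prop where
  f1 : ∀ a : (plecticComplex ϖ).Tot, f.f1.toMap ![a] = a
  f2 : ∀ a b : (plecticComplex ϖ).Tot,
    form0 (f.f2.toMap ![a, b]) = 0 ∧
    form1 (f.f2.toMap ![a, b]) = -contract (field a) (form0 b) ∧
    form2 (f.f2.toMap ![a, b]) = -contract (field a) (form1 b)
  f21 : f.f21.toMap = 0
  f3 : ∀ a b c : (plecticComplex ϖ).Tot,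
    form0 (f.f3.toMap ![a, b, c]) = 0 ∧
    form1 (f.f3.toMap ![a, b, c]) = 0 ∧
    form2 (f.f3.toMap ![a, b, c]) = -contract (field b) (contract (field a) (form0 c))

end Geometry

end ThreePlectic

end

/-!
Elements of positive degree and exact Hamiltonian forms have vanishing Hamiltonian vector field, so
every operation of the theorem is killed by two such arguments, and no Koszul sign in a composite
ever matters. With the signs gone, the equations are identities between the contractions
`ι(v_α)`, the bracket `ι(v_α, v_β)ω` and the Lie derivatives `ℒ(v_α)`. They follow from Cartan's
formula, the vanishing of five-fold contractions of `ω`, and the fact that the bracket of `α` and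
`β` is a Hamiltonian form for `[v_α, v_β]`. The latter yields `[ℒ(v_α), ι(v_β)] = ι(v_{λ₂(α, β)})`,
from which the remaining identities are formal. The inverse of the comparison morphism has
`g₂(α, β) = ι(v_α)β` and the same component of arity three.
-/

noncomputable section

namespace ThreePlectic

universe u v

section SignFree

variable {R : Type u} [CommRing R]

namespace ThreeTermComplex

variable {C : ThreeTermComplex.{u, v} R}

@[simp]
theorem d_d (x : C.Tot) : C.d (C.d x) = 0 := by
  have h : C.d1 (C.d2 x.2.2) = 0 := LinearMap.congr_fun C.d1_comp_d2 x.2.2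
  simp [d, h]

theorem d_mem_gr {x : C.Tot} {i : ℤ} (hx : x ∈ C.gr i) : C.d x ∈ C.gr (i - 1) := by
  obtain ⟨-, h1, h2⟩ := hx
  refine ⟨fun h => ?_, fun h => ?_, fun _ => rfl⟩
  · simp [d, h1 (by omega)]
  · simp [d, h2 (by omega)]

theorem d_eq_zero_of_mem_gr_zero {x : C.Tot} (hx : x ∈ C.gr 0) : C.d x = 0 := by
  simp [d, hx.2.1 zero_ne_one, hx.2.2 two_ne_zero.symm]

variable (C) in
/-- The elements whose component of degree `0` is a boundary. In the geometric case their
Hamiltonian vector field vanishes. Homogeneous elements of nonzero degree, which are the ones that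
contribute to Koszul signs, are negligible. -/
def negligible : Submodule R C.Tot :=
  (LinearMap.range C.d1).comap (LinearMap.fst R C.L0 (C.L1 × C.L2))

theorem mem_negligible_of_fst_eq_zero {x : C.Tot} (hx : x.1 = 0) : x ∈ C.negligible :=
  ⟨0, by simp [hx]⟩

theorem mem_negligible_of_mem_gr {x : C.Tot} {i : ℤ} (hx : x ∈ C.gr i) (hi : i ≠ 0) :
    x ∈ C.negligible :=
  mem_negligible_of_fst_eq_zero (hx.1 hi)

theorem d_mem_negligible (x : C.Tot) : C.d x ∈ C.negligible :=
  ⟨x.2.1, rfl⟩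

end ThreeTermComplex

section Signs

open ThreeTermComplex

variable {C D F : ThreeTermComplex.{u, v} R} {p q r s : ℤ} {n m k : ℕ}

instance : Zero (GMap C D p n) := ⟨⟨0, fun _ _ _ => zero_mem _⟩⟩

instance : Neg (GMap C D p n) := ⟨fun f => ⟨-f.toMap, fun e x hx => neg_mem (f.mem_gr e x hx)⟩⟩

theorem negOnePow_smul_eq_self {N : Type*} [AddCommGroup N] {a : ℤ} {y : N}
    (h : a ≠ 0 → y = 0) : a.negOnePow • y = y := by
  obtain rfl | ha := eq_or_ne a 0
  · simp
  · simp [h ha]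

theorem exists_mem_negligible_of_sum_ne_zero {ι : Type*} {t : Finset ι} {x : ι → ℤ × C.Tot}
    (hx : ∀ i, (x i).2 ∈ C.gr (x i).1) (h : ∑ i ∈ t, (x i).1 ≠ 0) :
    ∃ i ∈ t, (x i).2 ∈ C.negligible :=
  let ⟨i, hi, h⟩ := Finset.exists_ne_zero_of_sum_ne_zero h
  ⟨i, hi, mem_negligible_of_mem_gr (hx i) h⟩

/-- A graded multilinear map in which negligible elements behave like elements of positive degree
in a complex that is concentrated in degree `0`: two of them annihilate it. All Koszul signs in
compositions of such maps are trivial. -/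
structure GMap.IsSignFree (f : GMap C D p n) : Prop where
  mem_negligible : ∀ x i, x i ∈ C.negligible → f.toMap x ∈ D.negligible
  eq_zero : ∀ x i j, i ≠ j → x i ∈ C.negligible → x j ∈ C.negligible → f.toMap x = 0
  mem_negligible_of_degree_ne_zero : p ≠ 0 → ∀ x, f.toMap x ∈ D.negligible

/-- An operation that is annihilated by any two negligible arguments. -/
def Op.IsSignFree (f : Op C D p n) : Prop :=
  ∀ x i j, i ≠ j → (x i).2 ∈ C.negligible → (x j).2 ∈ C.negligible → f x = 0

theorem koszulSign_smul_eq_self {N : Type*} [AddCommGroup N] {σ : Equiv.Perm (Fin n)}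
    {e : Fin n → ℤ} {y : N} (h : ∀ i j, i ≠ j → e i ≠ 0 → e j ≠ 0 → y = 0) :
    koszulSign σ e • y = y := by
  by_cases he : ∃ i j, i ≠ j ∧ e i ≠ 0 ∧ e j ≠ 0
  · obtain ⟨i, j, hij, hi, hj⟩ := he
    rw [h i j hij hi hj, smul_zero]
  · suffices koszulSign σ e = 1 by rw [this, one_smul]
    refine Finset.prod_eq_one fun i _ => Finset.prod_eq_one fun j _ => ?_
    split_ifs with hij
    · have : e i * e j = 0 := by
        by_contra h0
        exact he ⟨i, j, hij.1.ne, left_ne_zero_of_mul h0, right_ne_zero_of_mul h0⟩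
      rw [this, Int.negOnePow_zero]
    · rfl

@[simp]
theorem Op.IsSignFree.act_apply {f : Op C D p n} (hf : f.IsSignFree) (σ : Equiv.Perm (Fin n))
    {x : Fin n → ℤ × C.Tot} (hx : ∀ i, (x i).2 ∈ C.gr (x i).1) :
    f.act σ x = f fun i => x (σ⁻¹ i) :=
  koszulSign_smul_eq_self fun i j hij hi hj =>
    hf _ (σ i) (σ j) (σ.injective.ne hij) (by simpa using mem_negligible_of_mem_gr (hx i) hi)
      (by simpa using mem_negligible_of_mem_gr (hx j) hj)

namespace GMap

theorem toMap_eq_zero_of_apply_eq_zero (f : GMap C D p n) {x : Fin n → C.Tot} {i : Fin n}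
    (h : x i = 0) : f.toMap x = 0 :=
  f.toMap.map_coord_zero i h

/-- The arguments of `f` in the partial composition `f ∘ᵢ g`, see `GMap.circ`. -/
def insertArgs (g : GMap C C q n) (i : Fin (m + 1)) (x : Fin (m + n) → C.Tot) (j : Fin (m + 1)) :
    C.Tot :=
  if h : j < i then x ⟨j, by omega⟩
  else if h' : j = i then g.toMap fun t : Fin n => x ⟨i + t, by omega⟩
  else x ⟨j + n - 1, by omega⟩

theorem insertArgs_self (g : GMap C C q n) (i : Fin (m + 1)) (x : Fin (m + n) → C.Tot) :
    g.insertArgs i x i = g.toMap fun t : Fin n => x ⟨i + t, by omega⟩ := by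
  simp [insertArgs]

theorem exists_insertArgs_eq (g : GMap C C q n) (i : Fin (m + 1)) (x : Fin (m + n) → C.Tot)
    (c : Fin (m + n)) :
    (∃ t : Fin n, c = ⟨i + t, by omega⟩) ∨ ∃ j, j ≠ i ∧ g.insertArgs i x j = x c ∧
      (j < i ∧ (c : ℕ) = j ∨ i < j ∧ (c : ℕ) + 1 = j + n) := by
  obtain h | h := lt_or_ge (c : ℕ) i
  · have hj : (⟨c, by omega⟩ : Fin (m + 1)) < i := h
    exact .inr ⟨_, hj.ne, by simp [insertArgs, hj], .inl ⟨hj, rfl⟩⟩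
  obtain h' | h' := lt_or_ge (c : ℕ) (i + n)
  · exact .inl ⟨⟨c - i, by omega⟩, Fin.ext (by simp; omega)⟩
  · have hj : i < (⟨c + 1 - n, by omega⟩ : Fin (m + 1)) := Fin.lt_def.2 (by simp; omega)
    refine .inr ⟨_, hj.ne', ?_, .inr ⟨hj, by simp; omega⟩⟩
    simp only [insertArgs, hj.not_gt, hj.ne', dite_false]
    exact congrArg x (Fin.ext (by simp; omega))

theorem circ_eq_smul (f : GMap C D p (m + 1)) (i : Fin (m + 1)) (g : GMap C C q n)
    (x : Fin (m + n) → ℤ × C.Tot) :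
    f.circ i g x = (q * ∑ j : Fin i, (x ⟨j, by omega⟩).1).negOnePow •
      f.toMap (g.insertArgs i fun j => (x j).2) := by
  refine congrArg (_ • f.toMap ·) (funext fun j => ?_)
  dsimp only [insertArgs]
  split_ifs <;> rfl

theorem comp2_eq_smul (h : GMap D F p 2) (f : GMap C D q m) (g : GMap C D r n)
    (x : Fin (m + n) → ℤ × C.Tot) :
    h.comp2 f g x = (r * ∑ i : Fin m, (x (i.castAdd n)).1).negOnePow •
      h.toMap ![f.toMap fun i => (x (i.castAdd n)).2, g.toMap fun i => (x (i.natAdd m)).2] := by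
  refine congrArg (_ • h.toMap ·) (funext fun i => ?_)
  fin_cases i <;> rfl

namespace IsSignFree

@[simp]
theorem op {f : GMap C D p n} (hf : f.IsSignFree) : f.op.IsSignFree :=
  fun _ i j hij hi hj => hf.eq_zero _ i j hij hi hj

theorem bd_apply {f : GMap C D p n} (hf : f.IsSignFree) {x : Fin n → ℤ × C.Tot}
    (hx : ∀ i, (x i).2 ∈ C.gr (x i).1) :
    f.bd x = D.d (f.toMap fun i => (x i).2) - p.negOnePow • ∑ i,
      f.toMap (Function.update (fun j => (x j).2) i (C.d (x i).2)) := by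
  refine congrArg (_ - p.negOnePow • ·) (Finset.sum_congr rfl fun i _ => ?_)
  have hupdate : (fun j => (Function.update x i ((x i).1 - 1, C.d (x i).2) j).2) =
      Function.update (fun j => (x j).2) i (C.d (x i).2) := by
    ext1 j
    exact Function.apply_update (fun _ => Prod.snd) x i _ j
  rw [GMap.op, hupdate]
  refine negOnePow_smul_eq_self fun h => ?_
  obtain ⟨j, hji, hj⟩ := exists_mem_negligible_of_sum_ne_zero hx h
  have hne : j ≠ i := (Finset.mem_filter.1 hji).2.ne
  exact hf.eq_zero _ i j hne.symm (by simpa using d_mem_negligible (x i).2)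
    (by simpa [hne] using hj)

@[simp]
theorem circ_apply {f : GMap C D p (m + 1)} {g : GMap C C q n} (hf : f.IsSignFree)
    (hg : g.IsSignFree) (i : Fin (m + 1)) {x : Fin (m + n) → ℤ × C.Tot}
    (hx : ∀ i, (x i).2 ∈ C.gr (x i).1) :
    f.circ i g x = f.toMap (g.insertArgs i fun j => (x j).2) := by
  rw [circ_eq_smul]
  refine negOnePow_smul_eq_self fun h => ?_
  obtain ⟨j, -, hj⟩ := exists_mem_negligible_of_sum_ne_zero
    (x := fun j : Fin i => x ⟨j, by omega⟩) (fun _ => hx _) (right_ne_zero_of_mul h)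
  refine hf.eq_zero _ ⟨j, by omega⟩ i (Fin.ne_of_lt j.2) ?_ ?_
  · simpa [insertArgs, Fin.lt_def] using hj
  · rw [insertArgs_self]
    exact hg.mem_negligible_of_degree_ne_zero (left_ne_zero_of_mul h) _

@[simp]
theorem comp2_apply {h : GMap D F p 2} {f : GMap C D q m} {g : GMap C D r n} (hh : h.IsSignFree)
    (hf : f.IsSignFree) (hg : g.IsSignFree) {x : Fin (m + n) → ℤ × C.Tot}
    (hx : ∀ i, (x i).2 ∈ C.gr (x i).1) :
    h.comp2 f g x = h.toMap ![f.toMap fun i => (x (i.castAdd n)).2,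
      g.toMap fun i => (x (i.natAdd m)).2] := by
  rw [comp2_eq_smul]
  refine negOnePow_smul_eq_self fun hsign => ?_
  obtain ⟨i, -, hi⟩ := exists_mem_negligible_of_sum_ne_zero (x := fun i : Fin m => x (i.castAdd n))
    (fun _ => hx _) (right_ne_zero_of_mul hsign)
  exact hh.eq_zero _ 0 1 zero_ne_one (hf.mem_negligible _ i hi)
    (hg.mem_negligible_of_degree_ne_zero (left_ne_zero_of_mul hsign) _)

@[simp]
theorem circ {f : GMap C D p (m + 1)} {g : GMap C C q n} (hf : f.IsSignFree)
    (hg : g.IsSignFree) (i : Fin (m + 1)) : (f.circ i g).IsSignFree := by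
  intro x a b hab ha hb
  rw [circ_eq_smul]
  refine smul_eq_zero_of_right _ ?_
  have inner : ∀ t : Fin n, (x ⟨i + t, by omega⟩).2 ∈ C.negligible →
      g.insertArgs i (fun c => (x c).2) i ∈ C.negligible := fun t ht => by
    rw [insertArgs_self]
    exact hg.mem_negligible _ t ht
  obtain ⟨s, rfl⟩ | ⟨j, hji, hj, hja⟩ := g.exists_insertArgs_eq i (fun c => (x c).2) a <;>
    obtain ⟨t, rfl⟩ | ⟨j', hji', hj', hjb⟩ := g.exists_insertArgs_eq i (fun c => (x c).2) b
  · refine f.toMap_eq_zero_of_apply_eq_zero (i := i) ?_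
    rw [insertArgs_self]
    exact hg.eq_zero _ s t (by rintro rfl; exact hab rfl) ha hb
  · exact hf.eq_zero _ i j' hji'.symm (inner s ha) (hj' ▸ hb)
  · exact hf.eq_zero _ j i hji (hj ▸ ha) (inner t hb)
  · have hjj' : j ≠ j' := by
      rintro rfl
      exact hab (Fin.ext (by omega))
    exact hf.eq_zero _ j j' hjj' (hj ▸ ha) (hj' ▸ hb)

@[simp]
theorem comp2 {h : GMap D F p 2} {f : GMap C D q m} {g : GMap C D r n} (hh : h.IsSignFree)
    (hf : f.IsSignFree) (hg : g.IsSignFree) : (h.comp2 f g).IsSignFree := by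
  intro x a b hab ha hb
  refine smul_eq_zero_of_right _ ?_
  induction a using Fin.addCases with
  | left s =>
    induction b using Fin.addCases with
    | left t =>
      exact h.toMap_eq_zero_of_apply_eq_zero (i := 0)
        (hf.eq_zero _ s t (by rintro rfl; exact hab rfl) ha hb)
    | right t =>
      exact hh.eq_zero _ 0 1 zero_ne_one (hf.mem_negligible _ s ha) (hg.mem_negligible _ t hb)
  | right s =>
    induction b using Fin.addCases with
    | left t =>
      exact hh.eq_zero _ 0 1 zero_ne_one (hf.mem_negligible _ t hb) (hg.mem_negligible _ s ha)
    | right t =>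
      exact h.toMap_eq_zero_of_apply_eq_zero (i := 1)
        (hg.eq_zero _ s t (by rintro rfl; exact hab rfl) ha hb)

end IsSignFree

end GMap

/-- A graded multilinear map that vanishes as soon as one argument is negligible, and hence
descends to the quotient by the negligible elements. -/
def GMap.Descends (f : GMap C D p n) : Prop :=
  ∀ x i, x i ∈ C.negligible → f.toMap x = 0

namespace GMap.Descends

theorem neg {f : GMap C D p n} (hf : f.Descends) : (-f).Descends :=
  fun x i hi => neg_eq_zero.2 (hf x i hi)

theorem bd_eq {f : GMap C D p n} (hf : f.Descends) : f.bd = fun x => D.d (f.op x) := by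
  funext x
  refine sub_eq_self.2 (smul_eq_zero_of_right _ (Finset.sum_eq_zero fun i _ => ?_))
  exact smul_eq_zero_of_right _ (hf _ i (by simpa using d_mem_negligible (x i).2))

theorem circ_eq_zero {f : GMap C D p (m + 1)} {g : GMap C C q n} (hf : f.Descends)
    (hg : g.IsSignFree) (hq : q ≠ 0) (i : Fin (m + 1)) : f.circ i g = 0 := by
  funext x
  rw [circ_eq_smul]
  refine smul_eq_zero_of_right _ (hf _ i ?_)
  rw [insertArgs_self]
  exact hg.mem_negligible_of_degree_ne_zero hq _

theorem comp2_eq_zero {h : GMap D F p 2} {f : GMap C D q m} {g : GMap C D r n} (hh : h.Descends)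
    (hf : f.IsSignFree) (hg : g.IsSignFree) (hdeg : q ≠ 0 ∨ r ≠ 0) : h.comp2 f g = 0 := by
  funext x
  refine smul_eq_zero_of_right _ ?_
  obtain hq | hr := hdeg
  · exact hh _ 0 (hf.mem_negligible_of_degree_ne_zero hq _)
  · exact hh _ 1 (hg.mem_negligible_of_degree_ne_zero hr _)

theorem comp3_eq_zero {h : GMap D F p 3} {f₀ : GMap C D q m} {f₁ : GMap C D r n}
    {f₂ : GMap C D s k} (hh : h.Descends) (hf₀ : f₀.IsSignFree) (hf₁ : f₁.IsSignFree)
    (hf₂ : f₂.IsSignFree) (hdeg : q ≠ 0 ∨ r ≠ 0 ∨ s ≠ 0) : h.comp3 f₀ f₁ f₂ = 0 := by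
  funext x
  refine smul_eq_zero_of_right _ ?_
  obtain hq | hr | hs := hdeg
  · exact hh _ 0 (hf₀.mem_negligible_of_degree_ne_zero hq _)
  · exact hh _ 1 (hf₁.mem_negligible_of_degree_ne_zero hr _)
  · exact hh _ 2 (hf₂.mem_negligible_of_degree_ne_zero hs _)

end GMap.Descends

end Signs

end SignFree

section Calculus

variable {R : Type u} [CommRing R] {C D F : ThreeTermComplex.{u, v} R} {p q r s : ℤ}
  {n m k : ℕ}

open ThreeTermComplex

section GradedMaps

@[simp]
theorem Op.zero_act (σ : Equiv.Perm (Fin n)) : (0 : Op C D p n).act σ = 0 := by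
  funext x
  simp [Op.act]

@[simp]
theorem Op.neg_act (f : Op C D p n) (σ : Equiv.Perm (Fin n)) : (-f).act σ = -f.act σ := by
  funext x
  simp [Op.act]

namespace GMap

@[simp]
theorem zero_toMap : (0 : GMap C D p n).toMap = 0 := rfl

@[simp]
theorem neg_toMap (f : GMap C D p n) : (-f).toMap = -f.toMap := rfl

variable (C) in
/-- The identity of a complex, as a graded multilinear map of arity `1`. -/
def id : GMap C C 0 1 where
  toMap := MultilinearMap.ofSubsingleton R C.Tot C.Tot 0 LinearMap.id
  mem_gr e x hx := by simpa using hx 0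

@[simp]
theorem id_toMap (x : Fin 1 → C.Tot) : (GMap.id C).toMap x = x 0 := rfl

@[simp]
theorem op_zero : (0 : GMap C D p n).op = 0 := rfl

@[simp]
theorem op_neg (f : GMap C D p n) : (-f).op = -f.op := rfl

@[simp]
theorem bd_zero : (0 : GMap C D p n).bd = 0 := by
  funext x
  simp [bd]

@[simp]
theorem zero_circ (i : Fin (m + 1)) (g : GMap C C q n) :
    (0 : GMap C D p (m + 1)).circ i g = 0 := by
  funext x
  simp [circ]

@[simp]
theorem neg_circ (f : GMap C D p (m + 1)) (i : Fin (m + 1)) (g : GMap C C q n) :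
    (-f).circ i g = -f.circ i g := by
  funext x
  simp [circ]

@[simp]
theorem circ_zero (f : GMap C D p (m + 1)) (i : Fin (m + 1)) :
    f.circ i (0 : GMap C C q n) = 0 := by
  funext x
  rw [circ_eq_smul, f.toMap_eq_zero_of_apply_eq_zero (insertArgs_self _ _ _), Pi.zero_apply,
    smul_zero]

@[simp]
theorem circ_neg (f : GMap C D p (m + 1)) (i : Fin (m + 1)) (g : GMap C C q n) :
    f.circ i (-g) = -f.circ i g := by
  funext x
  have hargs : (-g).insertArgs i (fun j => (x j).2) = Function.update
      (g.insertArgs i fun j => (x j).2) i (-g.insertArgs i (fun j => (x j).2) i) := by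
    ext1 j
    obtain rfl | hj := eq_or_ne j i
    · simp [insertArgs]
    · simp [insertArgs, hj]
  rw [Pi.neg_apply, circ_eq_smul, circ_eq_smul, hargs, f.toMap.map_update_neg,
    Function.update_eq_self, smul_neg]

@[simp]
theorem id_comp1 (f : GMap C D q n) : (GMap.id D).comp1 f = f.op := rfl

@[simp]
theorem compDiag_id (f : GMap C D p n) : f.compDiag (GMap.id C) = f.op := rfl

@[simp]
theorem comp2_zero_left (h : GMap D F p 2) (g : GMap C D r n) :
    h.comp2 (0 : GMap C D q m) g = 0 := by
  funext x
  exact smul_eq_zero_of_right _ (h.toMap_eq_zero_of_apply_eq_zero (i := 0) rfl)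

@[simp]
theorem comp2_zero_right (h : GMap D F p 2) (f : GMap C D q m) :
    h.comp2 f (0 : GMap C D r n) = 0 := by
  funext x
  exact smul_eq_zero_of_right _ (h.toMap_eq_zero_of_apply_eq_zero (i := 1) rfl)

@[simp]
theorem comp2_neg_left (h : GMap D F p 2) (f : GMap C D q m) (g : GMap C D r n) :
    h.comp2 (-f) g = -h.comp2 f g := by
  funext x
  rw [Pi.neg_apply, comp2_eq_smul, comp2_eq_smul, ← smul_neg]
  exact congrArg _ (DFunLike.congr_fun (map_neg h.toMap.curryLeft _) ![_])

@[simp]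
theorem comp2_neg_right (h : GMap D F p 2) (f : GMap C D q m) (g : GMap C D r n) :
    h.comp2 f (-g) = -h.comp2 f g := by
  funext x
  rw [Pi.neg_apply, comp2_eq_smul, comp2_eq_smul, ← smul_neg]
  exact congrArg _ (DFunLike.congr_fun (map_neg (h.toMap.curryLeft _).curryLeft _) ![])

@[simp]
theorem neg_comp2 (h : GMap D F p 2) (f : GMap C D q m) (g : GMap C D r n) :
    (-h).comp2 f g = -h.comp2 f g := by
  funext x
  simp [comp2]

@[simp]
theorem comp3_zero_left (f₀ : GMap C D q m) (f₁ : GMap C D r n) (f₂ : GMap C D s k) :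
    (0 : GMap D F p 3).comp3 f₀ f₁ f₂ = 0 := by
  funext x
  simp [comp3]

/-- The graded multilinear map of arity `2` given by a homogeneous bilinear map. -/
def ofBilin (f : C.Tot →ₗ[R] C.Tot →ₗ[R] D.Tot)
    (hf : ∀ a b i j, a ∈ C.gr i → b ∈ C.gr j → f a b ∈ D.gr (p + (i + j))) : GMap C D p 2 where
  toMap := MultilinearMap.mk' (fun x => f (x 0) (x 1))
    (by intro x i a b; fin_cases i <;> simp)
    (by intro x i c a; fin_cases i <;> simp)
  mem_gr e x hx := by
    rw [Fin.sum_univ_two]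
    exact hf _ _ _ _ (hx 0) (hx 1)

namespace IsSignFree

@[simp]
protected theorem zero : (0 : GMap C D p n).IsSignFree where
  mem_negligible _ _ _ := zero_mem _
  eq_zero _ _ _ _ _ _ := rfl
  mem_negligible_of_degree_ne_zero _ _ := zero_mem _

@[simp]
protected theorem neg {f : GMap C D p n} (hf : f.IsSignFree) : (-f).IsSignFree where
  mem_negligible x i hi := neg_mem (hf.mem_negligible x i hi)
  eq_zero x i j hij hi hj := neg_eq_zero.2 (hf.eq_zero x i j hij hi hj)
  mem_negligible_of_degree_ne_zero hp x := neg_mem (hf.mem_negligible_of_degree_ne_zero hp x)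

@[simp]
protected theorem id : (GMap.id C).IsSignFree where
  mem_negligible x i hi := by rwa [Subsingleton.elim i 0] at hi
  eq_zero _ i j hij := absurd (Subsingleton.elim i j) hij
  mem_negligible_of_degree_ne_zero h := absurd rfl h

theorem ofBilin {f : C.Tot →ₗ[R] C.Tot →ₗ[R] D.Tot}
    {hf : ∀ a b i j, a ∈ C.gr i → b ∈ C.gr j → f a b ∈ D.gr (p + (i + j))}
    (left : ∀ a ∈ C.negligible, ∀ b, f a b ∈ D.negligible)
    (right : ∀ a, ∀ b ∈ C.negligible, f a b ∈ D.negligible)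
    (both : ∀ a ∈ C.negligible, ∀ b ∈ C.negligible, f a b = 0)
    (degree : p ≠ 0 → ∀ a b, f a b ∈ D.negligible) : (GMap.ofBilin f hf).IsSignFree where
  mem_negligible x i hi := by
    fin_cases i
    exacts [left _ hi _, right _ _ hi]
  eq_zero x i j hij hi hj := by
    fin_cases i <;> fin_cases j
    exacts [absurd rfl hij, both _ hi _ hj, both _ hj _ hi, absurd rfl hij]
  mem_negligible_of_degree_ne_zero h x := degree h _ _

end IsSignFree

end GMap

end GradedMaps

/-- An abstract Cartan calculus on a three-term complex: `ι a b` is the contraction of `b` with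
the Hamiltonian vector field of `a`, and `bracket a b` is the contraction of the closed form with
the Hamiltonian vector fields of `a` and `b`. -/
structure CartanCalculus (C : ThreeTermComplex.{u, v} R) where
  ι : C.Tot →ₗ[R] C.Tot →ₗ[R] C.Tot
  bracket : C.Tot →ₗ[R] C.Tot →ₗ[R] C.Tot
  ι_mem_gr : ∀ a {b i}, b ∈ C.gr i → ι a b ∈ C.gr (i + 1)
  bracket_mem_gr : ∀ a b, bracket a b ∈ C.gr 0
  ι_eq_zero : ∀ a ∈ C.negligible, ι a = 0
  bracket_eq_zero : ∀ a ∈ C.negligible, bracket a = 0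
  ι_fst : ∀ a b, (ι a b).1 = 0
  ι_ι_swap : ∀ a b c, ι a (ι b c) = -ι b (ι a c)
  ι_ι_ι : ∀ a b c e, ι a (ι b (ι c e)) = 0
  bracket_swap : ∀ a b, bracket a b = -bracket b a
  ι_bracket_swap : ∀ a b c, ι a (bracket b c) = -ι b (bracket a c)
  lie_ι : ∀ a b c,
    C.d (ι a (ι b c)) + ι a (C.d (ι b c)) =
      ι b (C.d (ι a c) + ι a (C.d c) + bracket a c) + ι (bracket a b) c
  lie_bracket : ∀ a b c,
    C.d (ι a (bracket b c)) + bracket a (bracket b c) =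
      bracket (bracket a b) c + bracket b (bracket a c)

namespace CartanCalculus

attribute [simp] ι_ι_ι

variable (K : CartanCalculus C)

@[simp]
theorem d_bracket (a b : C.Tot) : C.d (K.bracket a b) = 0 :=
  d_eq_zero_of_mem_gr_zero (K.bracket_mem_gr a b)

theorem ι_mem_negligible (a b : C.Tot) : K.ι a b ∈ C.negligible :=
  mem_negligible_of_fst_eq_zero (K.ι_fst a b)

theorem bracket_eq_zero_right (a : C.Tot) {b : C.Tot} (hb : b ∈ C.negligible) :
    K.bracket a b = 0 := by
  rw [K.bracket_swap, K.bracket_eq_zero b hb, LinearMap.zero_apply, neg_zero]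

@[simp]
theorem ι_d_left (a : C.Tot) : K.ι (C.d a) = 0 := K.ι_eq_zero _ (d_mem_negligible a)

@[simp]
theorem ι_ι_left (a b : C.Tot) : K.ι (K.ι a b) = 0 := K.ι_eq_zero _ (K.ι_mem_negligible a b)

@[simp]
theorem bracket_d_left (a : C.Tot) : K.bracket (C.d a) = 0 :=
  K.bracket_eq_zero _ (d_mem_negligible a)

@[simp]
theorem bracket_d_right (a b : C.Tot) : K.bracket a (C.d b) = 0 :=
  K.bracket_eq_zero_right a (d_mem_negligible b)

@[simp]
theorem bracket_ι_left (a b : C.Tot) : K.bracket (K.ι a b) = 0 :=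
  K.bracket_eq_zero _ (K.ι_mem_negligible a b)

@[simp]
theorem bracket_ι_right (a b c : C.Tot) : K.bracket a (K.ι b c) = 0 :=
  K.bracket_eq_zero_right a (K.ι_mem_negligible b c)

/-- The Lie derivative of `b` along the Hamiltonian vector field of `a`. By Cartan's formula it is
`d (ι a b) + ι a (d b)`; for a Hamiltonian 2-form `b` the form `d b` is not part of the complex,
and its contraction is `bracket a b`. -/
def lie : C.Tot →ₗ[R] C.Tot →ₗ[R] C.Tot :=
  K.ι.compr₂ C.d + K.ι.compl₂ C.d + K.bracket

theorem lie_apply (a b : C.Tot) :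
    K.lie a b = C.d (K.ι a b) + K.ι a (C.d b) + K.bracket a b := rfl

theorem lie_eq_zero {a : C.Tot} (ha : a ∈ C.negligible) : K.lie a = 0 :=
  LinearMap.ext fun b => by simp [lie_apply, K.ι_eq_zero a ha, K.bracket_eq_zero a ha]

theorem lie_mem_negligible (a : C.Tot) {b : C.Tot} (hb : b ∈ C.negligible) :
    K.lie a b ∈ C.negligible := by
  rw [lie_apply, K.bracket_eq_zero_right a hb, add_zero]
  exact add_mem (d_mem_negligible _) (K.ι_mem_negligible _ _)

@[simp]
theorem lie_d_left (a : C.Tot) : K.lie (C.d a) = 0 := K.lie_eq_zero (d_mem_negligible a)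

@[simp]
theorem lie_ι_left (a b : C.Tot) : K.lie (K.ι a b) = 0 := K.lie_eq_zero (K.ι_mem_negligible a b)

@[simp]
theorem ι_lie_left (a b : C.Tot) : K.ι (K.lie a b) = K.ι (K.bracket a b) := by
  simp [lie_apply]

@[simp]
theorem bracket_lie_left (a b : C.Tot) : K.bracket (K.lie a b) = K.bracket (K.bracket a b) := by
  simp [lie_apply]

@[simp]
theorem bracket_lie_right (a b c : C.Tot) :
    K.bracket a (K.lie b c) = K.bracket a (K.bracket b c) := by
  simp [lie_apply]

@[simp]
theorem lie_lie_left (a b : C.Tot) : K.lie (K.lie a b) = K.lie (K.bracket a b) :=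
  LinearMap.ext fun c => by simp [lie_apply K (K.lie a b), lie_apply K (K.bracket a b)]

theorem d_ι (a b : C.Tot) : C.d (K.ι a b) = K.lie a b - K.ι a (C.d b) - K.bracket a b := by
  rw [lie_apply]
  abel

theorem d_lie (a b : C.Tot) : C.d (K.lie a b) = K.lie a (C.d b) := by
  simp [lie_apply]

theorem lie_ι_right (a b c : C.Tot) :
    K.lie a (K.ι b c) = K.ι b (K.lie a c) + K.ι (K.bracket a b) c := by
  rw [lie_apply, bracket_ι_right, add_zero, K.lie_ι, lie_apply]

theorem lie_bracket_right (a b c : C.Tot) :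
    K.lie a (K.bracket b c) = K.bracket (K.bracket a b) c + K.bracket b (K.bracket a c) := by
  rw [lie_apply, d_bracket, map_zero, add_zero, K.lie_bracket]

theorem lie_lie (a b c : C.Tot) :
    K.lie a (K.lie b c) = K.lie b (K.lie a c) + K.lie (K.bracket a b) c := by
  rw [K.lie_apply b c, map_add, map_add, ← d_lie, lie_ι_right, lie_ι_right, lie_bracket_right,
    ← d_lie, K.lie_apply b (K.lie a c), K.lie_apply (K.bracket a b) c, map_add, bracket_lie_right]
  abel

theorem ι_bracket_cyc (a b c : C.Tot) : K.ι a (K.bracket b c) = K.ι c (K.bracket a b) := by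
  rw [K.bracket_swap b c, map_neg, K.ι_bracket_swap a c b, neg_neg]

theorem ι_mem_gr_add {a b : C.Tot} {i j : ℤ} (ha : a ∈ C.gr i) (hb : b ∈ C.gr j) :
    K.ι a b ∈ C.gr (1 + (i + j)) := by
  obtain rfl | hi := eq_or_ne i 0
  · simpa [add_comm] using K.ι_mem_gr a hb
  · rw [K.ι_eq_zero a (mem_negligible_of_mem_gr ha hi)]
    exact zero_mem _

theorem bracket_mem_gr_add {a b : C.Tot} {i j : ℤ} (ha : a ∈ C.gr i) (hb : b ∈ C.gr j) :
    K.bracket a b ∈ C.gr (0 + (i + j)) := by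
  obtain rfl | hi := eq_or_ne i 0
  · obtain rfl | hj := eq_or_ne j 0
    · exact K.bracket_mem_gr a b
    · rw [K.bracket_eq_zero_right a (mem_negligible_of_mem_gr hb hj)]
      exact zero_mem _
  · rw [K.bracket_eq_zero a (mem_negligible_of_mem_gr ha hi)]
    exact zero_mem _

theorem lie_mem_gr_add {a b : C.Tot} {i j : ℤ} (ha : a ∈ C.gr i) (hb : b ∈ C.gr j) :
    K.lie a b ∈ C.gr (0 + (i + j)) := by
  refine add_mem (add_mem ?_ ?_) (K.bracket_mem_gr_add ha hb)
  · simpa using d_mem_gr (K.ι_mem_gr_add ha hb)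
  · rw [show 0 + (i + j) = 1 + (i + (j - 1)) by ring]
    exact K.ι_mem_gr_add ha (d_mem_gr hb)

/-- The graded multilinear map `(x₀, …, xₙ) ↦ ι(xᵢ) f(x₀, …, xᵢ₋₁, xᵢ₊₁, …, xₙ)`. -/
def contractAt (i : Fin (n + 1)) (f : GMap C C p n) : GMap C C (p + 1) (n + 1) where
  toMap := LinearMap.uncurryMid i
    { toFun a := (K.ι a).compMultilinearMap f.toMap
      map_add' a b := MultilinearMap.ext fun _ => by simp
      map_smul' c a := MultilinearMap.ext fun _ => by simp }
  mem_gr e x hx := by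
    rw [Fin.sum_univ_succAbove e i,
      show p + 1 + (e i + ∑ j, e (i.succAbove j)) = 1 + (e i + (p + ∑ j, e (i.succAbove j))) by
        ring]
    exact K.ι_mem_gr_add (hx i) (f.mem_gr _ _ fun j => hx _)

theorem contractAt_toMap (i : Fin (n + 1)) (f : GMap C C p n) (x : Fin (n + 1) → C.Tot) :
    (K.contractAt i f).toMap x = K.ι (x i) (f.toMap (i.removeNth x)) := rfl

theorem isSignFree_contractAt (i : Fin (n + 1)) {f : GMap C C p n} (hf : f.IsSignFree) :
    (K.contractAt i f).IsSignFree where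
  mem_negligible _ _ _ := K.ι_mem_negligible _ _
  eq_zero x j k hjk hj hk := by
    rw [contractAt_toMap]
    obtain rfl | ⟨j, rfl⟩ := i.eq_self_or_eq_succAbove j
    · rw [K.ι_eq_zero _ hj, LinearMap.zero_apply]
    obtain rfl | ⟨k, rfl⟩ := i.eq_self_or_eq_succAbove k
    · rw [K.ι_eq_zero _ hk, LinearMap.zero_apply]
    · rw [hf.eq_zero _ j k (by rintro rfl; exact hjk rfl) hj hk, map_zero]
  mem_negligible_of_degree_ne_zero _ _ := K.ι_mem_negligible _ _

theorem descends_contractAt (i : Fin (n + 1)) {f : GMap C C p n} (hf : f.Descends) :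
    (K.contractAt i f).Descends := by
  intro x j hj
  rw [contractAt_toMap]
  obtain rfl | ⟨j, rfl⟩ := i.eq_self_or_eq_succAbove j
  · rw [K.ι_eq_zero _ hj, LinearMap.zero_apply]
  · rw [hf _ j hj, map_zero]

/-- The bracket as a graded multilinear map; it is `λ₂` of `L_∞(M, ω)`. -/
def bracketMap : GMap C C 0 2 := .ofBilin K.bracket fun _ _ _ _ => K.bracket_mem_gr_add

/-- The Lie derivative as a graded multilinear map; it is `λ₂` of `Leib(M, ω)`. -/
def lieMap : GMap C C 0 2 := .ofBilin K.lie fun _ _ _ _ => K.lie_mem_gr_add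

/-- The symmetrised contraction `ι a b + ι b a`; it is `λ_{2;1}` of `Leib(M, ω)`. -/
def alternatorMap : GMap C C 1 2 := .ofBilin (K.ι + K.ι.flip) fun _ _ i j ha hb =>
  add_mem (K.ι_mem_gr_add ha hb) (add_comm i j ▸ K.ι_mem_gr_add hb ha)

/-- The threefold contraction of the closed form; `λ₃` of `L_∞(M, ω)` is its negative. -/
def bracketMap₃ : GMap C C 1 3 := K.contractAt 2 K.bracketMap

/-- The fourfold contraction of the closed form; `λ₄` of `L_∞(M, ω)` is its negative. -/
def bracketMap₄ : GMap C C 2 4 := K.contractAt 3 K.bracketMap₃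

/-- The contraction as a graded multilinear map of arity `2`; the component `f₂` is its negative. -/
def ιMap : GMap C C 1 2 := K.contractAt 0 (GMap.id C)

/-- The iterated contraction `ι a (ι b c)`; it is the component `f₃`. -/
def ιιMap : GMap C C 2 3 := K.contractAt 0 K.ιMap

@[simp]
theorem bracketMap_toMap (x) : K.bracketMap.toMap x = K.bracket (x 0) (x 1) := rfl

@[simp]
theorem lieMap_toMap (x) : K.lieMap.toMap x = K.lie (x 0) (x 1) := rfl

@[simp]
theorem alternatorMap_toMap (x) :
    K.alternatorMap.toMap x = K.ι (x 0) (x 1) + K.ι (x 1) (x 0) := rfl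

@[simp]
theorem ιMap_toMap (x) : K.ιMap.toMap x = K.ι (x 0) (x 1) := rfl

@[simp]
theorem ιιMap_toMap (x) : K.ιιMap.toMap x = K.ι (x 0) (K.ι (x 1) (x 2)) := rfl

theorem descends_bracketMap : K.bracketMap.Descends := by
  intro x i hi
  rw [bracketMap_toMap]
  fin_cases i
  · exact LinearMap.congr_fun (K.bracket_eq_zero _ hi) _
  · exact K.bracket_eq_zero_right _ hi

theorem descends_bracketMap₃ : K.bracketMap₃.Descends :=
  K.descends_contractAt 2 K.descends_bracketMap

theorem descends_bracketMap₄ : K.bracketMap₄.Descends :=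
  K.descends_contractAt 3 K.descends_bracketMap₃

@[simp]
theorem isSignFree_bracketMap : K.bracketMap.IsSignFree :=
  .ofBilin (fun a ha _ => by simp [K.bracket_eq_zero a ha])
    (fun a _ hb => by simp [K.bracket_eq_zero_right a hb])
    (fun a ha _ _ => by simp [K.bracket_eq_zero a ha]) (absurd rfl)

@[simp]
theorem isSignFree_lieMap : K.lieMap.IsSignFree :=
  .ofBilin (fun a ha _ => by simp [K.lie_eq_zero ha]) (fun a _ hb => K.lie_mem_negligible a hb)
    (fun a ha _ _ => by simp [K.lie_eq_zero ha]) (absurd rfl)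

@[simp]
theorem isSignFree_alternatorMap : K.alternatorMap.IsSignFree :=
  have mem (a b : C.Tot) : K.ι a b + K.ι b a ∈ C.negligible :=
    add_mem (K.ι_mem_negligible a b) (K.ι_mem_negligible b a)
  .ofBilin (fun a _ b => mem a b) (fun a b _ => mem a b)
    (fun a ha b hb => by simp [K.ι_eq_zero a ha, K.ι_eq_zero b hb]) (fun _ => mem)

@[simp]
theorem isSignFree_bracketMap₃ : K.bracketMap₃.IsSignFree :=
  K.isSignFree_contractAt 2 K.isSignFree_bracketMap

@[simp]
theorem isSignFree_bracketMap₄ : K.bracketMap₄.IsSignFree :=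
  K.isSignFree_contractAt 3 K.isSignFree_bracketMap₃

@[simp]
theorem isSignFree_ιMap : K.ιMap.IsSignFree := K.isSignFree_contractAt 0 .id

@[simp]
theorem isSignFree_ιιMap : K.ιιMap.IsSignFree := K.isSignFree_contractAt 0 K.isSignFree_ιMap

end CartanCalculus

end Calculus

theorem neg_add_neg_eq_zero {N : Type*} [AddCommGroup N] {a b : N} (h : a + b = 0) :
    -a + -b = 0 := by
  rw [← neg_add, h, neg_zero]

section Identities

variable {R : Type u} [CommRing R] {C : ThreeTermComplex.{u, v} R} (K : CartanCalculus C)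

open GMap Op.IsSignFree GMap.IsSignFree

namespace CartanCalculus

theorem bracket_jacobi (a b c : C.Tot) :
    K.bracket a (K.bracket b c) - K.bracket (K.bracket a b) c - K.bracket b (K.bracket a c) =
      -C.d (K.ι c (K.bracket a b)) := by
  rw [← K.ι_bracket_cyc a b c, d_ι, lie_bracket_right, d_bracket, map_zero]
  abel

theorem ι_lie_bracket (a b c e : C.Tot) :
    K.ι c (K.lie e (K.bracket a b)) =
      K.ι (K.bracket b e) (K.bracket a c) - K.ι (K.bracket a e) (K.bracket b c) := by
  rw [lie_bracket_right, map_add, K.ι_bracket_cyc c _ b, K.ι_bracket_cyc b c, K.ι_bracket_cyc c a,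
    K.bracket_swap e a, K.bracket_swap e b, K.bracket_swap c a]
  simp only [map_neg, LinearMap.neg_apply, neg_neg]
  abel

theorem neg_d_ι_ι_bracket (a b c e : C.Tot) :
    -C.d (K.ι e (K.ι c (K.bracket a b))) =
      K.ι e (K.bracket (K.bracket a b) c) - K.ι e (K.bracket a (K.bracket b c))
        + K.ι e (K.bracket b (K.bracket a c)) + K.ι (K.bracket c e) (K.bracket a b)
        - K.ι (K.bracket b e) (K.bracket a c) + K.ι (K.bracket a e) (K.bracket b c) := by
  have d_ι_bracket := neg_eq_iff_eq_neg.1 (K.bracket_jacobi a b c).symm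
  rw [d_ι, lie_ι_right, ι_lie_bracket, bracket_ι_right, d_ι_bracket, K.bracket_swap e c]
  simp only [map_sub, map_neg, LinearMap.neg_apply]
  abel

theorem ι_ι_bracket_cocycle (a b c d e : C.Tot) :
    0 = -K.ι e (K.ι d (K.bracket (K.bracket a b) c)) + K.ι e (K.ι d (K.bracket a (K.bracket b c)))
      - K.ι e (K.ι d (K.bracket b (K.bracket a c))) - K.ι e (K.ι (K.bracket c d) (K.bracket a b))
      + K.ι e (K.ι (K.bracket b d) (K.bracket a c)) - K.ι e (K.ι (K.bracket a d) (K.bracket b c))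
      + K.ι (K.bracket d e) (K.ι c (K.bracket a b)) - K.ι (K.bracket c e) (K.ι d (K.bracket a b))
      + K.ι (K.bracket b e) (K.ι d (K.bracket a c))
      - K.ι (K.bracket a e) (K.ι d (K.bracket b c)) := by
  have cartan := K.lie_apply e (K.ι d (K.ι c (K.bracket a b)))
  rw [ι_ι_ι, map_zero, zero_add, bracket_ι_right, add_zero, lie_ι_right, lie_ι_right, map_add,
    ι_lie_bracket, ← neg_neg (C.d _), neg_d_ι_ι_bracket, K.bracket_swap e c,
    K.bracket_swap e d] at cartan
  simp only [map_add, map_sub, map_neg, LinearMap.neg_apply, K.ι_ι_swap d] at cartan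
  rw [← sub_eq_zero.2 cartan.symm]
  abel

theorem ι_ι_lie_cyc (a b c e : C.Tot) :
    K.ι b (K.ι c (K.lie a e)) + K.ι b (K.ι (K.bracket a c) e) + K.ι (K.bracket a b) (K.ι c e)
      - K.ι a (K.ι c (K.lie b e)) - K.ι a (K.ι (K.bracket b c) e) + K.ι a (K.ι b (K.lie c e)) =
    K.ι a (K.ι b (K.bracket c e)) := by
  have h := K.d_ι a (K.ι b (K.ι c e))
  rw [ι_ι_ι, map_zero] at h
  simp only [d_ι, lie_ι_right, bracket_ι_right, map_sub, map_add, sub_zero, ι_ι_ι] at h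
  rw [← sub_eq_zero, h]
  abel

theorem bracket_add_swap (a b : C.Tot) : K.bracket a b + K.bracket b a = 0 :=
  add_eq_zero_iff_eq_neg.2 (K.bracket_swap a b)

theorem ι_ι_add_swap (a b c : C.Tot) : K.ι a (K.ι b c) + K.ι b (K.ι a c) = 0 :=
  add_eq_zero_iff_eq_neg.2 (K.ι_ι_swap a b c)

theorem ι_bracket_add_swap_right (a b c : C.Tot) :
    K.ι a (K.bracket b c) + K.ι c (K.bracket b a) = 0 := by
  rw [K.ι_bracket_cyc a b c, ← map_add, bracket_add_swap, map_zero]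

theorem ι_bracket_add_bracket_swap (a b c : C.Tot) :
    K.ι c (K.bracket a b) + K.ι c (K.bracket b a) = 0 := by
  rw [← map_add, bracket_add_swap, map_zero]

theorem ι_ι_bracket_add_swap_right (a b c e : C.Tot) :
    K.ι e (K.ι a (K.bracket b c)) + K.ι e (K.ι c (K.bracket b a)) = 0 := by
  rw [← map_add, ι_bracket_add_swap_right, map_zero]

theorem ι_ι_bracket_add_bracket_swap (a b c e : C.Tot) :
    K.ι e (K.ι c (K.bracket a b)) + K.ι e (K.ι c (K.bracket b a)) = 0 := by
  rw [← map_add, ι_bracket_add_bracket_swap, map_zero]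

theorem ι_ι_bracket_antisymm (a b c e : C.Tot) :
    K.ι a (K.ι e (K.bracket b c)) = K.ι a (K.ι b (K.bracket c e)) ∧
    K.ι b (K.ι e (K.bracket a c)) = -K.ι a (K.ι b (K.bracket c e)) ∧
    K.ι c (K.ι e (K.bracket a b)) = K.ι a (K.ι b (K.bracket c e)) ∧
    K.ι a (K.ι c (K.bracket b e)) = -K.ι a (K.ι b (K.bracket c e)) ∧
    K.ι b (K.ι c (K.bracket a e)) = K.ι a (K.ι b (K.bracket c e)) ∧
    K.ι e (K.ι c (K.bracket a b)) = -K.ι a (K.ι b (K.bracket c e)) := by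
  have h : K.ι c (K.ι e (K.bracket a b)) = K.ι a (K.ι b (K.bracket c e)) := by
    rw [← K.ι_bracket_cyc a b e, K.ι_ι_swap c a, K.ι_bracket_swap c b, map_neg, neg_neg]
  refine ⟨?_, ?_, h, ?_, ?_, ?_⟩
  · rw [K.ι_bracket_cyc b c e]
  · rw [← K.ι_bracket_cyc a c e, K.ι_ι_swap b a]
  · rw [K.ι_bracket_swap c b, map_neg]
  · rw [K.ι_bracket_swap c a, map_neg, K.ι_ι_swap b a, neg_neg]
  · rw [K.ι_ι_swap e c, h]

theorem neg_d_ι_sub_ι_d (a b : C.Tot) :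
    -C.d (K.ι a b) - K.ι a (C.d b) = K.bracket a b - K.lie a b := by
  rw [d_ι]
  abel

theorem d_ι_add_ι_d (a b : C.Tot) :
    C.d (K.ι a b) + K.ι a (C.d b) = K.lie a b - K.bracket a b := by
  rw [d_ι]
  abel

theorem d_ι_ι_sub_ι_ι_d_eq_bracket (a b c : C.Tot) :
    C.d (K.ι a (K.ι b c)) - K.ι a (K.ι b (C.d c)) =
      -K.ι c (K.bracket a b) + K.ι a (K.bracket b c) - K.ι (K.bracket a b) c
        - K.ι b (K.bracket a c) + K.lie a (K.ι b c) - K.lie b (K.ι a c) := by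
  rw [d_ι, d_ι, K.lie_ι_right b, K.bracket_swap b a, ← K.ι_bracket_cyc a b c, K.ι_bracket_swap b a]
  simp only [map_sub, map_neg, LinearMap.neg_apply, bracket_ι_right]
  abel

theorem d_ι_ι_sub_ι_ι_d_eq_lie (a b c : C.Tot) :
    C.d (K.ι a (K.ι b c)) - K.ι a (K.ι b (C.d c)) =
      -K.ι a (K.lie b c) + K.ι (K.lie a b) c + K.ι b (K.lie a c) + K.ι c (K.bracket a b) := by
  rw [d_ι_ι_sub_ι_ι_d_eq_bracket, lie_ι_right, lie_ι_right, ι_lie_left, ← K.ι_bracket_cyc a b c,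
    K.ι_bracket_swap b a, K.bracket_swap b a]
  simp only [map_neg, LinearMap.neg_apply]
  abel

theorem neg_ι_ι_bracket_eq (a b c e : C.Tot) :
    -K.ι e (K.ι c (K.bracket a b)) =
      K.ι (K.ι c (K.bracket a b)) e + K.ι a (K.ι e (K.bracket b c)) - K.ι b (K.ι e (K.bracket a c))
        + K.ι c (K.ι e (K.bracket a b)) - K.ι (K.bracket a b) (K.ι c e)
        + K.ι a (K.ι (K.bracket b c) e) - K.ι b (K.ι (K.bracket a c) e)
        - K.ι a (K.ι b (K.bracket c e)) + K.ι a (K.ι c (K.bracket b e))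
        - K.ι b (K.ι c (K.bracket a e)) + K.lie a (K.ι b (K.ι c e)) - K.lie b (K.ι a (K.ι c e))
        + K.lie c (K.ι a (K.ι b e)) := by
  obtain ⟨h₁, h₂, h₃, h₄, h₅, h₆⟩ := K.ι_ι_bracket_antisymm a b c e
  rw [h₁, h₂, h₃, h₄, h₅, h₆, ← K.ι_ι_lie_cyc a b c e]
  simp only [lie_ι_right, map_add, ι_ι_left, LinearMap.zero_apply, K.bracket_swap b a,
    K.bracket_swap c a, K.bracket_swap c b, map_neg, LinearMap.neg_apply,
    K.ι_ι_swap (K.bracket a c) b]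
  abel

theorem ι_ι_bracket_eq (a b c e : C.Tot) :
    K.ι e (K.ι c (K.bracket a b)) =
      -K.ι (K.lie a b) (K.ι c e) + K.ι a (K.ι (K.lie b c) e) - K.ι b (K.ι (K.lie a c) e)
        - K.ι a (K.ι b (K.lie c e)) + K.ι a (K.ι c (K.lie b e)) - K.ι b (K.ι c (K.lie a e)) := by
  obtain ⟨-, -, -, -, -, h⟩ := K.ι_ι_bracket_antisymm a b c e
  rw [h, ← K.ι_ι_lie_cyc a b c e]
  simp only [ι_lie_left]
  abel

theorem ι_ι_add_swap_left (a b c : C.Tot) :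
    0 = K.ι a (K.ι b c) + K.ι b (K.ι a c) + K.ι (K.ι a b + K.ι b a) c := by
  rw [ι_ι_add_swap, map_add, ι_ι_left, ι_ι_left, zero_add, zero_add, LinearMap.zero_apply]

theorem ι_ι_add_swap_right (a b c : C.Tot) :
    0 = K.ι a (K.ι b c) + K.ι a (K.ι c b) + K.ι c (K.ι a b) + K.ι b (K.ι a c) := by
  rw [K.ι_ι_swap c a, K.ι_ι_swap b a]
  abel

theorem lie_add_lie_swap (a b : C.Tot) :
    C.d (K.ι a b) + C.d (K.ι b a) - (-K.ι b (C.d a) + -K.ι a (C.d b)) = K.lie a b + K.lie b a := by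
  rw [lie_apply, lie_apply, K.bracket_swap b a]
  abel

theorem lie_alternator (a b c : C.Tot) :
    0 = -K.lie a (K.ι b c + K.ι c b) + (K.ι (K.lie a b) c + K.ι c (K.lie a b))
      + (K.ι b (K.lie a c) + K.ι (K.lie a c) b) := by
  rw [map_add, lie_ι_right, lie_ι_right, ι_lie_left, ι_lie_left]
  abel

theorem lie_jacobi (a b c : C.Tot) :
    K.lie a (K.lie b c) - K.lie (K.lie a b) c - K.lie b (K.lie a c) = 0 := by
  rw [lie_lie, lie_lie_left]
  abel

theorem ι_alternator_cyc (a b c : C.Tot) :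
    0 = (K.ι a (K.ι b c + K.ι c b) + K.ι (K.ι b c + K.ι c b) a)
      + (K.ι (K.ι a b + K.ι b a) c + K.ι c (K.ι a b + K.ι b a))
      + (K.ι b (K.ι a c + K.ι c a) + K.ι (K.ι a c + K.ι c a) b) := by
  simp only [map_add, LinearMap.add_apply, ι_ι_left, LinearMap.zero_apply]
  rw [K.ι_ι_swap a b, K.ι_ι_swap a c, K.ι_ι_swap c b]
  abel

/-- The weak Lie 3-algebra given by the bracket, with `l3` and `l4` as higher homotopies. -/
def lInfinity : WeakLie3Algebra C where
  l2 := K.bracketMap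
  l21 := 0
  l211 := 0
  l3 := -K.bracketMap₃
  l31 := 0
  l32 := 0
  l4 := -K.bracketMap₄
  leib2 _ _ := by
    rw [K.descends_bracketMap.bd_eq]
    exact K.d_bracket _ _
  leib3 x hx := by
    rw [K.descends_bracketMap₃.neg.bd_eq]
    simp only [op_neg, Pi.neg_apply, map_neg, Pi.sub_apply, isSignFree_bracketMap, hx, implies_true,
      circ_apply, IsSignFree.circ, act_apply]
    exact (K.bracket_jacobi (x 0).2 (x 1).2 (x 2).2).symm
  leib4 x hx := by
    rw [K.descends_bracketMap₄.neg.bd_eq]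
    simp only [op_neg, Pi.neg_apply, map_neg, isSignFree_bracketMap₃, IsSignFree.neg, ne_eq,
      one_ne_zero, not_false_eq_true, K.descends_bracketMap.circ_eq_zero, Op.zero_act, sub_self,
      neg_circ, sub_neg_eq_add, zero_add, ← sub_eq_add_neg, Op.neg_act, Pi.sub_apply, Pi.add_apply,
      isSignFree_bracketMap, hx, implies_true, circ_apply, IsSignFree.circ, act_apply]
    exact K.neg_d_ι_ι_bracket (x 0).2 (x 1).2 (x 2).2 (x 3).2
  leib5 x hx := by
    simp only [isSignFree_bracketMap₄, IsSignFree.neg, ne_eq, OfNat.ofNat_ne_zero,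
      not_false_eq_true, K.descends_bracketMap.circ_eq_zero, sub_self, Op.zero_act, add_zero,
      isSignFree_bracketMap₃, one_ne_zero, K.descends_bracketMap₃.neg.circ_eq_zero, neg_circ,
      ← sub_eq_add_neg, zero_sub, sub_neg_eq_add, Op.neg_act, Pi.add_apply, Pi.sub_apply,
      Pi.neg_apply, isSignFree_bracketMap, hx, implies_true, circ_apply, IsSignFree.circ, act_apply]
    exact K.ι_ι_bracket_cocycle (x 0).2 (x 1).2 (x 2).2 (x 3).2 (x 4).2
  bd_l21 x hx := by
    simp only [bd_zero, Pi.add_apply, isSignFree_bracketMap, IsSignFree.op, hx, implies_true,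
      act_apply]
    exact (K.bracket_add_swap (x 0).2 (x 1).2).symm
  bd_l211 _ _ := by simp
  bd_l31 x hx := by
    simp only [bd_zero, Pi.zero_apply, op_neg, Op.neg_act, circ_zero, Pi.add_apply, Pi.neg_apply,
      isSignFree_bracketMap₃, IsSignFree.op, hx, implies_true, act_apply, add_zero]
    exact (neg_add_neg_eq_zero (K.ι_bracket_add_bracket_swap (x 0).2 (x 1).2 (x 2).2)).symm
  bd_l32 x hx := by
    simp only [bd_zero, Pi.zero_apply, op_neg, Op.neg_act, circ_zero, sub_zero, zero_circ, add_zero,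
      Op.zero_act, Pi.add_apply, Pi.neg_apply, isSignFree_bracketMap₃, IsSignFree.op, hx,
      implies_true, act_apply]
    exact (neg_add_neg_eq_zero (K.ι_bracket_add_swap_right (x 2).2 (x 0).2 (x 1).2)).symm
  sym_l211 _ _ := by simp
  sym_l31 _ _ := by simp
  sym_l31_l32 _ _ := by simp
  sym_l32 _ _ := by simp
  sym_l4_12 x hx := by
    simp only [op_neg, Op.neg_act, Pi.add_apply, Pi.neg_apply, isSignFree_bracketMap₄,
      IsSignFree.op, hx, implies_true, act_apply, circ_zero, zero_circ, sub_self, Op.zero_act,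
      add_zero, Pi.zero_apply]
    exact neg_add_neg_eq_zero (K.ι_ι_bracket_add_bracket_swap (x 0).2 (x 1).2 (x 2).2 (x 3).2)
  sym_l4_23 x hx := by
    simp only [op_neg, Op.neg_act, Pi.add_apply, Pi.neg_apply, isSignFree_bracketMap₄,
      IsSignFree.op, hx, implies_true, act_apply, circ_zero, sub_self, add_zero, zero_circ,
      Op.zero_act]
    exact neg_add_neg_eq_zero (K.ι_ι_bracket_add_swap_right (x 2).2 (x 0).2 (x 1).2 (x 3).2)
  sym_l4_34 x hx := by
    simp only [op_neg, Op.neg_act, Pi.add_apply, Pi.neg_apply, isSignFree_bracketMap₄,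
      IsSignFree.op, hx, implies_true, act_apply, zero_circ, sub_self, add_zero, Op.zero_act,
      circ_zero, Pi.zero_apply]
    exact neg_add_neg_eq_zero (K.ι_ι_add_swap (x 3).2 (x 2).2 (K.bracket (x 0).2 (x 1).2))

/-- The weak Lie 3-algebra given by the Lie derivative and its alternator. -/
def leib : WeakLie3Algebra C where
  l2 := K.lieMap
  l21 := K.alternatorMap
  l211 := 0
  l3 := 0
  l31 := 0
  l32 := 0
  l4 := 0
  leib2 x hx := by
    rw [K.isSignFree_lieMap.bd_apply hx]
    simp only [lieMap_toMap, Int.negOnePow_zero, Fin.sum_univ_two, Function.update_self, lie_d_left,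
      LinearMap.zero_apply, zero_add, one_smul]
    exact sub_eq_zero.2 (K.d_lie _ _)
  leib3 x hx := by
    simp only [bd_zero, Pi.sub_apply, isSignFree_lieMap, hx, implies_true, circ_apply,
      IsSignFree.circ, act_apply]
    exact (K.lie_jacobi (x 0).2 (x 1).2 (x 2).2).symm
  leib4 _ _ := by simp
  leib5 _ _ := by simp
  bd_l21 x hx := by
    rw [K.isSignFree_alternatorMap.bd_apply hx]
    simp only [alternatorMap_toMap, map_add, Int.negOnePow_one, Fin.sum_univ_two,
      Function.update_self, ι_d_left, LinearMap.zero_apply, zero_add, add_zero, smul_add,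
      Units.neg_smul, one_smul, Pi.add_apply, isSignFree_lieMap, IsSignFree.op, hx, implies_true,
      act_apply]
    exact K.lie_add_lie_swap (x 0).2 (x 1).2
  bd_l211 x hx := by
    simp only [bd_zero, Pi.sub_apply, isSignFree_alternatorMap, IsSignFree.op, hx, implies_true,
      act_apply]
    exact (sub_eq_zero.2 (add_comm (K.ι (x 0).2 (x 1).2) (K.ι (x 1).2 (x 0).2))).symm
  bd_l31 x hx := by simp [hx, GMap.insertArgs]
  bd_l32 x hx := by
    simp only [bd_zero, op_zero, Op.zero_act, add_zero, zero_sub, Pi.add_apply, Pi.neg_apply,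
      isSignFree_lieMap, isSignFree_alternatorMap, hx, implies_true, circ_apply, IsSignFree.circ,
      act_apply]
    exact K.lie_alternator (x 0).2 (x 1).2 (x 2).2
  sym_l211 _ _ := by simp
  sym_l31 _ _ := by simp
  sym_l31_l32 x hx := by
    simp only [op_zero, Op.zero_act, sub_self, add_zero, Pi.zero_apply, zero_circ, Pi.add_apply,
      isSignFree_alternatorMap, hx, implies_true, circ_apply, IsSignFree.circ, act_apply]
    exact K.ι_alternator_cyc (x 0).2 (x 1).2 (x 2).2
  sym_l32 _ _ := by simp
  sym_l4_12 _ _ := by simp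
  sym_l4_23 _ _ := by simp
  sym_l4_34 _ _ := by simp

/-- The weak morphism from `lInfinity` to `leib` given by contraction. -/
def comparison : WeakMorphism K.lInfinity K.leib where
  f1 := GMap.id C
  f2 := -K.ιMap
  f21 := 0
  f3 := K.ιιMap
  leib1 x hx := by
    rw [IsSignFree.id.bd_apply hx]
    simp
  leib2 x hx := by
    rw [K.isSignFree_ιMap.neg.bd_apply hx]
    simp only [neg_toMap, neg_apply, ιMap_toMap, map_neg, Int.negOnePow_one, Finset.sum_neg_distrib,
      Fin.sum_univ_two, Function.update_self, ι_d_left, LinearMap.zero_apply, zero_add,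
      Units.neg_smul, one_smul, neg_neg]
    exact K.neg_d_ι_sub_ι_d (x 0).2 (x 1).2
  leib3 x hx := by
    rw [K.isSignFree_ιιMap.bd_apply hx]
    simp only [ιιMap_toMap, Int.negOnePow_even 2 even_two, Fin.sum_univ_three, Function.update_self,
      ι_d_left, LinearMap.zero_apply, map_zero, zero_add, one_smul, lInfinity, neg_circ,
      sub_neg_eq_add, ← sub_eq_add_neg, Op.neg_act, leib, compDiag_id, op_zero, sub_zero,
      comp2_neg_right, comp2_neg_left, Pi.add_apply, Pi.sub_apply, Pi.neg_apply, isSignFree_ιMap,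
      isSignFree_bracketMap, hx, implies_true, circ_apply, ιMap_toMap, IsSignFree.circ, act_apply,
      isSignFree_lieMap, IsSignFree.id, comp2_apply, lieMap_toMap, Matrix.cons_val_zero, lie_ι_left,
      IsSignFree.comp2]
    exact K.d_ι_ι_sub_ι_ι_d_eq_bracket (x 0).2 (x 1).2 (x 2).2
  leib4 x hx := by
    simp only [lInfinity, leib, compDiag_id, op_zero, Pi.sub_apply, Pi.zero_apply, sub_zero,
      circ_neg, neg_circ, neg_neg, comp2_neg_right, comp2_neg_left, comp3_zero_left, add_zero,
      Op.zero_act, Pi.add_apply, isSignFree_ιMap, isSignFree_bracketMap₃, hx, implies_true,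
      circ_apply, ιMap_toMap, IsSignFree.circ, act_apply, isSignFree_ιιMap, isSignFree_bracketMap,
      ιιMap_toMap, isSignFree_lieMap, IsSignFree.id, comp2_apply, lieMap_toMap,
      Matrix.cons_val_zero, lie_ι_left, LinearMap.zero_apply, IsSignFree.comp2]
    exact K.neg_ι_ι_bracket_eq (x 0).2 (x 1).2 (x 2).2 (x 3).2
  bd_f21 x hx := by
    simp only [bd_zero, op_neg, neg_neg, Op.neg_act, sub_neg_eq_add, lInfinity, id_comp1, op_zero,
      add_zero, Pi.sub_apply, Pi.add_apply, isSignFree_ιMap, IsSignFree.op, hx, implies_true,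
      act_apply]
    exact (sub_self (K.ι (x 0).2 (x 1).2 + K.ι (x 1).2 (x 0).2)).symm
  sym_l211 _ _ := by simp [lInfinity, leib]
  sym_l31 x hx := by
    simp only [lInfinity, id_comp1, leib, compDiag_id, Pi.zero_apply, sub_self, circ_zero, add_zero,
      comp2_zero_left, Pi.add_apply, isSignFree_ιιMap, IsSignFree.op, hx, implies_true, act_apply]
    exact (K.ι_ι_add_swap (x 0).2 (x 1).2 (x 2).2).symm
  sym_l32 x hx := by
    simp only [lInfinity, op_zero, leib, compDiag_id, circ_zero, sub_zero, zero_circ, add_zero,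
      Op.zero_act, comp2_zero_right, comp2_neg_left, sub_neg_eq_add, comp2_neg_right, Op.neg_act,
      Pi.add_apply, isSignFree_ιιMap, IsSignFree.op, hx, implies_true, act_apply,
      isSignFree_alternatorMap, isSignFree_ιMap, IsSignFree.id, comp2_apply, ιMap_toMap,
      alternatorMap_toMap, Matrix.cons_val_zero, ι_ι_left, Matrix.cons_val_one,
      LinearMap.zero_apply, zero_add, IsSignFree.comp2]
    exact K.ι_ι_add_swap_right (x 0).2 (x 1).2 (x 2).2

/-- The inverse of `comparison`. -/
def comparisonInv : WeakMorphism K.leib K.lInfinity where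
  f1 := GMap.id C
  f2 := K.ιMap
  f21 := 0
  f3 := K.ιιMap
  leib1 x hx := by
    rw [IsSignFree.id.bd_apply hx]
    simp
  leib2 x hx := by
    rw [K.isSignFree_ιMap.bd_apply hx]
    simp only [ιMap_toMap, Int.negOnePow_one, Fin.sum_univ_two, Function.update_self, ι_d_left,
      LinearMap.zero_apply, zero_add, Units.neg_smul, one_smul, sub_neg_eq_add]
    exact K.d_ι_add_ι_d (x 0).2 (x 1).2
  leib3 x hx := by
    rw [K.isSignFree_ιιMap.bd_apply hx]
    simp only [ιιMap_toMap, Int.negOnePow_even 2 even_two, Fin.sum_univ_three, Function.update_self,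
      ι_d_left, ne_eq, one_ne_zero, not_false_eq_true, LinearMap.zero_apply, map_zero, add_zero,
      zero_add, one_smul, leib, id_comp1, op_zero, zero_sub, lInfinity, compDiag_id, op_neg,
      sub_neg_eq_add, IsSignFree.id, isSignFree_ιMap, not_true_eq_false, or_true,
      K.descends_bracketMap.comp2_eq_zero, sub_zero, or_false, Op.zero_act, Pi.add_apply,
      Pi.neg_apply, isSignFree_lieMap, hx, implies_true, circ_apply, IsSignFree.circ, act_apply,
      Pi.zero_apply]
    exact K.d_ι_ι_sub_ι_ι_d_eq_lie (x 0).2 (x 1).2 (x 2).2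
  leib4 x hx := by
    simp only [leib, id_comp1, op_zero, lInfinity, compDiag_id, op_neg, Pi.sub_apply, Pi.zero_apply,
      Pi.neg_apply, sub_neg_eq_add, zero_add, circ_zero, add_zero, Op.zero_act, zero_sub,
      isSignFree_ιιMap, IsSignFree.id, ne_eq, OfNat.ofNat_ne_zero, not_false_eq_true,
      not_true_eq_false, or_false, K.descends_bracketMap.comp2_eq_zero, or_true, sub_zero,
      isSignFree_ιMap, one_ne_zero, K.descends_bracketMap₃.neg.comp3_eq_zero, Pi.add_apply,
      isSignFree_lieMap, hx, implies_true, circ_apply, IsSignFree.circ, act_apply]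
    exact K.ι_ι_bracket_eq (x 0).2 (x 1).2 (x 2).2 (x 3).2
  bd_f21 x hx := by
    simp only [bd_zero, Pi.zero_apply, lInfinity, compDiag_id, op_zero, Pi.sub_apply, Pi.add_apply,
      isSignFree_ιMap, IsSignFree.op, hx, implies_true, act_apply, sub_zero]
    exact (by abel : 0 = -K.ι (x 0).2 (x 1).2 - K.ι (x 1).2 (x 0).2
      + (K.ι (x 0).2 (x 1).2 + K.ι (x 1).2 (x 0).2))
  sym_l211 _ _ := by simp [lInfinity, leib]
  sym_l31 x hx := by
    simp only [leib, id_comp1, lInfinity, compDiag_id, Pi.zero_apply, sub_self, comp2_zero_left,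
      Pi.add_apply, isSignFree_ιιMap, IsSignFree.op, hx, implies_true, act_apply, isSignFree_ιMap,
      isSignFree_alternatorMap, circ_apply, add_zero]
    exact K.ι_ι_add_swap_left (x 0).2 (x 1).2 (x 2).2
  sym_l32 x hx := by
    simp only [leib, op_zero, lInfinity, compDiag_id, Pi.sub_apply, Pi.zero_apply, zero_circ,
      add_zero, Op.zero_act, comp2_zero_right, sub_zero, Pi.add_apply, isSignFree_ιιMap,
      IsSignFree.op, hx, implies_true, act_apply, isSignFree_ιMap, isSignFree_alternatorMap,
      circ_apply, IsSignFree.zero, IsSignFree.id, comp2_apply, zero_toMap, zero_apply,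
      IsSignFree.comp2]
    exact (sub_eq_zero.2
      (map_add (K.ι (x 0).2) (K.ι (x 1).2 (x 2).2) (K.ι (x 2).2 (x 1).2)).symm).symm

theorem comparison_isIso : K.comparison.IsIso := by
  have cancel (a b c : C.Tot) :
      K.ι a (K.ι b c) + -K.ι a (K.ι b c) + K.ι b (K.ι a c) + K.ι a (K.ι b c) = 0 := by
    rw [K.ι_ι_swap b a]
    abel
  refine ⟨K.comparisonInv, ⟨?_, ?_, ?_, ?_⟩, ⟨?_, ?_, ?_, ?_⟩⟩ <;> intro x hx
  · rfl
  · simp [comparison, comparisonInv]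
  · simp [comparison, comparisonInv]
  · simp only [comparisonInv, comparison, comp2_neg_left, sub_neg_eq_add, comp2_neg_right,
      Op.neg_act, Pi.add_apply, isSignFree_ιMap, IsSignFree.id, hx, implies_true, comp2_apply,
      ιMap_toMap, Matrix.cons_val_zero, ι_ι_left, LinearMap.zero_apply, add_zero, Pi.neg_apply,
      IsSignFree.comp2, act_apply]
    exact cancel (x 0).2 (x 1).2 (x 2).2
  · rfl
  · simp [comparison, comparisonInv]
  · simp [comparison, comparisonInv]
  · simp only [comparison, comparisonInv, neg_comp2, sub_neg_eq_add, Op.neg_act, Pi.add_apply,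
      isSignFree_ιMap, IsSignFree.id, hx, implies_true, comp2_apply, ιMap_toMap,
      Matrix.cons_val_zero, ι_ι_left, LinearMap.zero_apply, add_zero, Pi.neg_apply,
      IsSignFree.comp2, act_apply]
    exact cancel (x 0).2 (x 1).2 (x 2).2

end CartanCalculus

end Identities

section LocalCalculus

variable {𝕜 : Type*} [NontriviallyNormedField 𝕜] {E : Type*} [NormedAddCommGroup E]
  [NormedSpace 𝕜 E] {F : Type*} [NormedAddCommGroup F] [NormedSpace 𝕜 F] {k : ℕ}

open ContinuousAlternatingMap

/-- The Lie derivative at `y` of a differential form on a normed space along a vector field. -/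
def lieAt (V : E → E) (α : E → E [⋀^Fin k]→L[𝕜] F) (y : E) (u : Fin k → E) : F :=
  fderiv 𝕜 α y (V y) u + ∑ i, α y (Function.update u i (fderiv 𝕜 V y (u i)))

theorem lieAt_congr {V : E → E} {α β : E → E [⋀^Fin k]→L[𝕜] F} {y : E} (h : α =ᶠ[nhds y] β)
    (u : Fin k → E) : lieAt V α y u = lieAt V β y u := by
  simp only [lieAt, h.fderiv_eq, h.eq_of_nhds]

theorem fderiv_curryLeft_apply {V : E → E} {α : E → E [⋀^Fin (k + 1)]→L[𝕜] F} {y : E}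
    (hV : DifferentiableAt 𝕜 V y) (hα : DifferentiableAt 𝕜 α y) (h : E) :
    fderiv 𝕜 (fun z => (α z).curryLeft (V z)) y h =
      (fderiv 𝕜 α y h).curryLeft (V y) + (α y).curryLeft (fderiv 𝕜 V y h) := by
  let curry := (curryLeftLI (𝕜 := 𝕜) (E := E) (F := F) (n := k)).toContinuousLinearMap
  have curry_α : HasFDerivAt (fun z => curry (α z)) (curry ∘L fderiv 𝕜 α y) y :=
    HasFDerivAt.comp (f := α) (g := curry) y curry.hasFDerivAt hα.hasFDerivAt
  refine (congrArg (fun T => T h) (curry_α.clm_apply hV.hasFDerivAt).fderiv).trans ?_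
  simp only [_root_.add_apply, ContinuousLinearMap.comp_apply, ContinuousLinearMap.flip_apply]
  exact add_comm _ _

theorem removeNth_succ_vecCons {E : Type*} (v : E) (u : Fin (k + 1) → E) (i : Fin (k + 1)) :
    i.succ.removeNth (Matrix.vecCons v u : Fin (k + 2) → E) =
      Matrix.vecCons v (i.removeNth u) := by
  funext j
  refine Fin.cases ?_ (fun j => ?_) j <;> simp [Fin.removeNth]

theorem extDeriv_curryLeft_eq_lieAt {α : E → E [⋀^Fin 0]→L[𝕜] F} (V : E → E) (y : E)
    (u : Fin 0 → E) : (extDeriv α y).curryLeft (V y) u = lieAt V α y u := by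
  rw [extDeriv, curryLeft_apply_apply, alternatizeUncurryFin_apply, lieAt]
  simp

theorem extDeriv_curryLeft_add_eq_lieAt {V : E → E} {α : E → E [⋀^Fin (k + 1)]→L[𝕜] F} {y : E}
    (hV : DifferentiableAt 𝕜 V y) (hα : DifferentiableAt 𝕜 α y) (u : Fin (k + 1) → E) :
    extDeriv (fun z => (α z).curryLeft (V z)) y u + (extDeriv α y).curryLeft (V y) u =
      lieAt V α y u := by
  have term_d_contract (i : Fin (k + 1)) : (-1 : ℤ) ^ (i : ℕ) •
      fderiv 𝕜 (fun z => (α z).curryLeft (V z)) y (u i) (i.removeNth u) =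
      (-1 : ℤ) ^ (i : ℕ) • fderiv 𝕜 α y (u i) (Matrix.vecCons (V y) (i.removeNth u)) +
      α y (Function.update u i (fderiv 𝕜 V y (u i))) := by
    rw [fderiv_curryLeft_apply hV hα, ContinuousAlternatingMap.add_apply, smul_add,
      curryLeft_apply_apply, curryLeft_apply_apply, ← map_insertNth, Fin.insertNth_removeNth,
      ← map_insertNth, Fin.insertNth_removeNth]
  have term_contract_d (i : Fin (k + 1)) : (-1 : ℤ) ^ (i.succ : ℕ) •
      fderiv 𝕜 α y (Matrix.vecCons (V y) u i.succ)
        (i.succ.removeNth (Matrix.vecCons (V y) u : Fin (k + 2) → E)) =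
      -((-1 : ℤ) ^ (i : ℕ) •
        fderiv 𝕜 α y (u i) (Matrix.vecCons (V y) (i.removeNth u))) := by
    rw [removeNth_succ_vecCons, Fin.val_succ, pow_succ, Matrix.cons_val_succ]
    simp
  rw [extDeriv, extDeriv, curryLeft_apply_apply, alternatizeUncurryFin_apply,
    alternatizeUncurryFin_apply, lieAt, Fin.sum_univ_succ (n := k + 1)]
  simp_rw [term_d_contract, term_contract_d]
  rw [Finset.sum_add_distrib, Finset.sum_neg_distrib]
  simp only [Fin.val_zero, pow_zero, Matrix.cons_val_zero, Fin.removeNth_zero, one_smul]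
  abel

theorem lieAt_curryLeft {V W : E → E} {α : E → E [⋀^Fin (k + 1)]→L[𝕜] F} {y : E}
    (hW : DifferentiableAt 𝕜 W y) (hα : DifferentiableAt 𝕜 α y) (u : Fin k → E) :
    lieAt V (fun z => (α z).curryLeft (W z)) y u =
      lieAt V α y (Matrix.vecCons (W y) u) +
        (α y).curryLeft (VectorField.lieBracket 𝕜 V W y) u := by
  have update_succ (i : Fin k) : Function.update (Matrix.vecCons (W y) u : Fin (k + 1) → E) i.succ
      (fderiv 𝕜 V y (u i)) = Matrix.vecCons (W y) (Function.update u i (fderiv 𝕜 V y (u i))) :=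
    (Fin.cons_update (α := fun _ => E) (W y) u i _).symm
  have update_zero : Function.update (Matrix.vecCons (W y) u : Fin (k + 1) → E) 0
      (fderiv 𝕜 V y (W y)) = Matrix.vecCons (fderiv 𝕜 V y (W y)) u :=
    Fin.update_cons_zero (α := fun _ => E) _ _ _
  rw [lieAt, lieAt, fderiv_curryLeft_apply hW hα, Fin.sum_univ_succ, VectorField.lieBracket]
  simp only [Matrix.cons_val_zero, Matrix.cons_val_succ, update_succ, update_zero, map_sub,
    ContinuousAlternatingMap.add_apply, curryLeft_apply_apply, ContinuousAlternatingMap.sub_apply]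
  abel

end LocalCalculus

section ManifoldCalculus

open scoped Manifold ContDiff

variable {E : Type u} [NormedAddCommGroup E] [NormedSpace ℝ E]
  {M : Type v} [TopologicalSpace M] [ChartedSpace E M] {k : ℕ}

theorem localField_apply (x : M) (v : ∀ x : M, TangentSpace 𝓘(ℝ, E) x) :
    localField x v (extChartAt 𝓘(ℝ, E) x x) =
      mfderiv 𝓘(ℝ, E) 𝓘(ℝ, E) (extChartAt 𝓘(ℝ, E) x) x (v x) := by
  let G : M → E := fun p => mfderiv 𝓘(ℝ, E) 𝓘(ℝ, E) (extChartAt 𝓘(ℝ, E) x) p (v p)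
  exact congrArg G (extChartAt_to_inv (I := 𝓘(ℝ, E)) x)

theorem contract_contract (v w : ∀ x : M, TangentSpace 𝓘(ℝ, E) x) (α : PreForm E M (k + 2)) :
    contract v (contract w α) = -contract w (contract v α) := by
  funext x
  refine ContinuousAlternatingMap.ext fun u => ?_
  have h := (α x).map_swap (Matrix.vecCons (v x) (Matrix.vecCons (w x) u))
    (i := 0) (j := 1) (by simp)
  refine Eq.trans (congrArg (α x) (funext fun i => ?_)) h
  refine Fin.cases rfl (fun i => Fin.cases rfl (fun i => ?_) i) i
  rw [Function.comp_apply, Equiv.swap_apply_of_ne_of_ne (Fin.succ_ne_zero _)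
    (by simp [Fin.ext_iff])]
  rfl

/-- The Lie derivative of a form of positive degree along a vector field, defined by Cartan's
formula. -/
def lieForm (v : ∀ x : M, TangentSpace 𝓘(ℝ, E) x) (α : PreForm E M (k + 1)) :
    PreForm E M (k + 1) :=
  extD (contract v α) + contract v (extD α)

variable [IsManifold 𝓘(ℝ, E) ∞ M]

theorem mfderiv_symm_mfderiv (a : M) {x : M} (hx : x ∈ (extChartAt 𝓘(ℝ, E) a).source)
    (v : TangentSpace 𝓘(ℝ, E) x) :
    mfderiv 𝓘(ℝ, E) 𝓘(ℝ, E) (extChartAt 𝓘(ℝ, E) a).symm (extChartAt 𝓘(ℝ, E) a x)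
      (mfderiv 𝓘(ℝ, E) 𝓘(ℝ, E) (extChartAt 𝓘(ℝ, E) a) x v) = v := by
  have : IsManifold 𝓘(ℝ, E) 1 M := .of_le (n := ∞) (by simp)
  have h := mfderivWithin_extChartAt_symm_comp_mfderiv_extChartAt' (I := 𝓘(ℝ, E)) hx
  rw [modelWithCornersSelf_coe, Set.range_id, mfderivWithin_univ] at h
  exact congrArg (fun T => T v) h

theorem apply_eq_localForm (α : PreForm E M k) (x : M) (u : Fin k → TangentSpace 𝓘(ℝ, E) x) :
    α x u = localForm x α (extChartAt 𝓘(ℝ, E) x x)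
      (fun i => mfderiv 𝓘(ℝ, E) 𝓘(ℝ, E) (extChartAt 𝓘(ℝ, E) x) x (u i)) := by
  let G : M → (Fin k → E) → ℝ := fun p w => α p w
  exact congrArg₂ G (extChartAt_to_inv (I := 𝓘(ℝ, E)) x).symm
    (funext fun i => (mfderiv_symm_mfderiv x (mem_extChartAt_source x) (u i)).symm)

theorem localForm_contract (a : M) (v : ∀ x : M, TangentSpace 𝓘(ℝ, E) x)
    (α : PreForm E M (k + 1)) {y : E} (hy : y ∈ (extChartAt 𝓘(ℝ, E) a).target) :
    localForm a (contract v α) y = (localForm a α y).curryLeft (localField a v y) := by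
  let p : M := (extChartAt 𝓘(ℝ, E) a).symm y
  let dsymm : E →L[ℝ] E := mfderiv 𝓘(ℝ, E) 𝓘(ℝ, E) (extChartAt 𝓘(ℝ, E) a).symm y
  let αp : E [⋀^Fin (k + 1)]→L[ℝ] ℝ := α p
  have field_eq : dsymm (localField a v y) = v p := by
    have h := mfderiv_symm_mfderiv a ((extChartAt 𝓘(ℝ, E) a).map_target hy) (v p)
    rwa [(extChartAt 𝓘(ℝ, E) a).right_inv hy] at h
  calc localForm a (contract v α) y
      = (αp.curryLeft (dsymm (localField a v y))).compContinuousLinearMap dsymm :=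
        congrArg (fun w : E => (αp.curryLeft w).compContinuousLinearMap dsymm) field_eq.symm
    _ = (localForm a α y).curryLeft (localField a v y) :=
        (ContinuousAlternatingMap.curryLeft_compContinuousLinearMap αp dsymm _).symm

theorem localForm_contract_eventuallyEq (x : M) (v : ∀ x : M, TangentSpace 𝓘(ℝ, E) x)
    (α : PreForm E M (k + 1)) :
    localForm x (contract v α) =ᶠ[nhds (extChartAt 𝓘(ℝ, E) x x)]
      fun z => (localForm x α z).curryLeft (localField x v z) := by
  filter_upwards [(isOpen_extChartAt_target (I := 𝓘(ℝ, E)) x).mem_nhds (mem_extChartAt_target x)]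
    with y hy using localForm_contract x v α hy

theorem localField_contDiffOn (a : M) (v : VectorField E M) :
    ContDiffOn ℝ ∞ (localField a v) (extChartAt 𝓘(ℝ, E) a).target := by
  have : IsManifold 𝓘(ℝ, E) 1 M := .of_le (n := ∞) (by simp)
  let e := trivializationAt E (TangentSpace 𝓘(ℝ, E) : M → Type _) a
  have mem_chart_source {y : E} (hy : y ∈ (extChartAt 𝓘(ℝ, E) a).target) :
      (extChartAt 𝓘(ℝ, E) a).symm y ∈ (chartAt E a).source := by
    simpa only [extChartAt_source] using (extChartAt 𝓘(ℝ, E) a).map_target hy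
  have smooth_coord : ContMDiffOn 𝓘(ℝ, E) 𝓘(ℝ, E) ∞ (fun x => (e ⟨x, v x⟩).2) e.baseSet :=
    (e.contMDiffOn_section_baseSet_iff (IB := 𝓘(ℝ, E)) (n := ∞) (s := v)).1
      v.contMDiff.contMDiffOn
  have smooth_comp := smooth_coord.comp
    (contMDiffOn_extChartAt_symm (n := ∞) (I := 𝓘(ℝ, E)) a) fun y hy => by
      simpa [e] using mem_chart_source hy
  refine (contMDiffOn_iff_contDiffOn.1 smooth_comp).congr fun y hy => ?_
  have hs := mem_chart_source hy
  refine (congrArg (fun T => T (v ((extChartAt 𝓘(ℝ, E) a).symm y)))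
    (TangentBundle.continuousLinearMapAt_trivializationAt (𝕜 := ℝ) (I := 𝓘(ℝ, E)) hs)).symm.trans ?_
  rw [Bundle.Trivialization.continuousLinearMapAt_apply,
    Bundle.Trivialization.linearMapAt_apply, if_pos (by simpa using hs)]
  rfl

theorem localField_differentiableAt (a : M) (v : VectorField E M) {y : E}
    (hy : y ∈ (extChartAt 𝓘(ℝ, E) a).target) : DifferentiableAt ℝ (localField a v) y :=
  ((localField_contDiffOn a v).contDiffAt
    ((isOpen_extChartAt_target a).mem_nhds hy)).differentiableAt (by simp)

theorem IsSmooth.contract {α : PreForm E M (k + 1)} (hα : IsSmooth α) (v : VectorField E M) :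
    IsSmooth (contract v α) := fun a => by
  let curry : (E [⋀^Fin (k + 1)]→L[ℝ] ℝ) →L[ℝ] E →L[ℝ] E [⋀^Fin k]→L[ℝ] ℝ :=
    (ContinuousAlternatingMap.curryLeftLI (𝕜 := ℝ) (E := E) (F := ℝ) (n := k)).toContinuousLinearMap
  have curry_smooth : ContDiff ℝ ∞ curry := by exact ContinuousLinearMap.contDiff _
  exact ((curry_smooth.comp_contDiffOn (hα a)).clm_apply (localField_contDiffOn a v)).congr
    fun _ hy => localForm_contract a v α hy

theorem extD_contract_add {α : PreForm E M (k + 1)} (hα : IsSmooth α) (v : VectorField E M) (x : M)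
    (u : Fin (k + 1) → TangentSpace 𝓘(ℝ, E) x) :
    (extD (contract v α) + contract v (extD α)) x u = lieDeriv v α x u := by
  have hx := mem_extChartAt_target (I := 𝓘(ℝ, E)) x
  rw [apply_eq_localForm, localForm_add, Pi.add_apply, localForm_extD (hα.contract v) x hx,
    localForm_contract x v _ hx, localForm_extD hα x hx,
    (localForm_contract_eventuallyEq x v α).extDeriv_eq]
  exact extDeriv_curryLeft_add_eq_lieAt (localField_differentiableAt x v hx)
    ((localForm_contDiffAt hα x hx).differentiableAt (by simp)) _

theorem contract_extD {α : PreForm E M 0} (hα : IsSmooth α) (v : ∀ x : M, TangentSpace 𝓘(ℝ, E) x)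
    (x : M) (u : Fin 0 → TangentSpace 𝓘(ℝ, E) x) :
    contract v (extD α) x u = lieDeriv v α x u := by
  have hx := mem_extChartAt_target (I := 𝓘(ℝ, E)) x
  rw [apply_eq_localForm, localForm_contract x v _ hx, localForm_extD hα x hx]
  exact extDeriv_curryLeft_eq_lieAt _ _ _

theorem mpullbackWithin_eq_localField (a : M) (v : ∀ x : M, TangentSpace 𝓘(ℝ, E) x) {y : E}
    (hy : y ∈ (extChartAt 𝓘(ℝ, E) a).target) :
    VectorField.mpullbackWithin 𝓘(ℝ, E) 𝓘(ℝ, E) (extChartAt 𝓘(ℝ, E) a).symm v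
      (Set.range 𝓘(ℝ, E)) y = localField a v y := by
  have : IsManifold 𝓘(ℝ, E) 1 M := .of_le (n := ∞) (by simp)
  have h := ContinuousLinearMap.inverse_eq
    (mfderivWithin_extChartAt_symm_comp_mfderiv_extChartAt (I := 𝓘(ℝ, E)) hy)
    (mfderiv_extChartAt_comp_mfderivWithin_extChartAt_symm (I := 𝓘(ℝ, E)) hy)
  exact congrArg (fun T => T (v ((extChartAt 𝓘(ℝ, E) a).symm y))) h

theorem mfderiv_mlieBracket (v w : ∀ x : M, TangentSpace 𝓘(ℝ, E) x) (x : M) :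
    mfderiv 𝓘(ℝ, E) 𝓘(ℝ, E) (extChartAt 𝓘(ℝ, E) x) x (VectorField.mlieBracket 𝓘(ℝ, E) v w x) =
      VectorField.lieBracket ℝ (localField x v) (localField x w) (extChartAt 𝓘(ℝ, E) x x) := by
  have : IsManifold 𝓘(ℝ, E) 1 M := .of_le (n := ∞) (by simp)
  let pullback : (∀ x : M, TangentSpace 𝓘(ℝ, E) x) → E → E := fun v =>
    VectorField.mpullbackWithin 𝓘(ℝ, E) 𝓘(ℝ, E) (extChartAt 𝓘(ℝ, E) x).symm v
      (Set.range 𝓘(ℝ, E))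
  have pullback_eq (v) : pullback v =ᶠ[nhds (extChartAt 𝓘(ℝ, E) x x)] localField x v := by
    filter_upwards [(isOpen_extChartAt_target (I := 𝓘(ℝ, E)) x).mem_nhds
      (mem_extChartAt_target x)] with y hy using mpullbackWithin_eq_localField x v hy
  obtain ⟨z, hz⟩ : ∃ z : E, VectorField.lieBracket ℝ (localField x v) (localField x w)
    (extChartAt 𝓘(ℝ, E) x x) = z := ⟨_, rfl⟩
  have mlieBracket_eq : VectorField.mlieBracket 𝓘(ℝ, E) v w x =
      (mfderiv 𝓘(ℝ, E) 𝓘(ℝ, E) (extChartAt 𝓘(ℝ, E) x) x).inverse z := by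
    rw [← hz, ← (pullback_eq v).lieBracket_vectorField_eq (𝕜 := ℝ) (pullback_eq w),
      ← VectorField.lieBracketWithin_univ]
    refine (VectorField.mlieBracketWithin_apply (I := 𝓘(ℝ, E)) (s := Set.univ)).trans ?_
    simp only [pullback, modelWithCornersSelf_coe, Set.range_id, Set.preimage_univ,
      Set.inter_univ]
  obtain ⟨e, he⟩ := isInvertible_mfderiv_extChartAt (I := 𝓘(ℝ, E)) (mem_extChartAt_source x)
  rw [mlieBracket_eq, hz, ← he, ContinuousLinearMap.inverse_equiv]
  exact e.apply_symm_apply _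

theorem lieDeriv_contract {α : PreForm E M (k + 1)} (hα : IsSmooth α)
    (v : ∀ x : M, TangentSpace 𝓘(ℝ, E) x) (w : VectorField E M) (x : M)
    (u : Fin k → TangentSpace 𝓘(ℝ, E) x) :
    lieDeriv v (contract w α) x u = lieDeriv v α x (Matrix.vecCons (w x) u) +
      α x (Matrix.vecCons (VectorField.mlieBracket 𝓘(ℝ, E) v w x) u) := by
  have hx := mem_extChartAt_target (I := 𝓘(ℝ, E)) x
  let y : E := extChartAt 𝓘(ℝ, E) x x
  let Φ : TangentSpace 𝓘(ℝ, E) x → E := mfderiv 𝓘(ℝ, E) 𝓘(ℝ, E) (extChartAt 𝓘(ℝ, E) x) x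
  have vecCons_map {z : TangentSpace 𝓘(ℝ, E) x} {z' : E} (hz : z' = Φ z) :
      (Matrix.vecCons z' (fun i => Φ (u i)) : Fin (k + 1) → E) =
      fun i => Φ ((Matrix.vecCons z u : Fin (k + 1) → TangentSpace 𝓘(ℝ, E) x) i) :=
    hz ▸ funext (Fin.cases rfl fun _ => rfl)
  calc lieDeriv v (contract w α) x u
      = lieAt (localField x v) (localForm x α) y
            (Matrix.vecCons (localField x w y) fun i => Φ (u i)) +
          (localForm x α y).curryLeft
            (VectorField.lieBracket ℝ (localField x v) (localField x w) y) (fun i => Φ (u i)) :=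
        (lieAt_congr (localForm_contract_eventuallyEq x w α) _).trans
          (lieAt_curryLeft (localField_differentiableAt x w hx)
            ((localForm_contDiffAt hα x hx).differentiableAt (by simp)) _)
    _ = _ := congrArg₂ (fun s t => s + t)
        (congrArg (lieAt (localField x v) (localForm x α) y)
          (vecCons_map (localField_apply x w)))
        ((congrArg (localForm x α y) (vecCons_map (mfderiv_mlieBracket v w x).symm)).trans
          (apply_eq_localForm α x _).symm)

variable [CompleteSpace E]

/-- The Lie bracket of smooth vector fields. -/
def fieldBracket (v w : VectorField E M) : VectorField E M :=
  haveI : IsManifold 𝓘(ℝ, E) (∞ + 1) M := inferInstanceAs (IsManifold 𝓘(ℝ, E) ∞ M)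
  haveI : IsManifold 𝓘(ℝ, E) (minSmoothness ℝ 2) M := .of_le two_le
  ⟨VectorField.mlieBracket 𝓘(ℝ, E) v w, fun x =>
    ContMDiffAt.mlieBracket_vectorField (m := ⊤) (n := ⊤) (v.contMDiff x) (w.contMDiff x)
      (by rw [minSmoothness_of_isRCLikeNormedField]; exact le_rfl)⟩

theorem lieForm_contract {α : PreForm E M (k + 2)} (hα : IsSmooth α) (v w : VectorField E M) :
    lieForm v (contract w α) = contract w (lieForm v α) + contract (fieldBracket v w) α := by
  funext x
  refine ContinuousAlternatingMap.ext fun u => ?_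
  rw [lieForm, extD_contract_add (hα.contract w), lieDeriv_contract hα, ← extD_contract_add hα]
  rfl

theorem contract_extD_contract {α : PreForm E M 1} (hα : IsSmooth α) (v w : VectorField E M) :
    contract v (extD (contract w α)) =
      contract w (lieForm v α) + contract (fieldBracket v w) α := by
  funext x
  refine ContinuousAlternatingMap.ext fun u => ?_
  rw [contract_extD (hα.contract w), lieDeriv_contract hα, ← extD_contract_add hα]
  rfl

end ManifoldCalculus

section Plectic

open scoped Manifold ContDiff
open plecticComplex

variable {E : Type u} [NormedAddCommGroup E] [NormedSpace ℝ E]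
  {M : Type v} [TopologicalSpace M] [ChartedSpace E M] [IsManifold 𝓘(ℝ, E) ∞ M] {k m : ℕ}

/-- The contraction of smooth forms with smooth vector fields. -/
def Form.contract : VectorField E M →ₗ[ℝ] Form E M (k + 1) →ₗ[ℝ] Form E M k :=
  LinearMap.mk₂ ℝ (fun v α => ⟨ThreePlectic.contract v α.1, IsSmooth.contract α.2 v⟩)
    (fun v w α => Subtype.ext (funext fun x =>
      map_add (ContinuousAlternatingMap.curryLeft (E := E) (α.1 x)) (v x) (w x)))
    (fun c v α => Subtype.ext (funext fun x =>
      map_smul (ContinuousAlternatingMap.curryLeft (E := E) (α.1 x)) c (v x)))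
    (fun _ _ _ => rfl) (fun _ _ _ => rfl)

theorem Form.contract_contract (v w : VectorField E M) (α : Form E M (k + 2)) :
    contract v (contract w α) = -contract w (contract v α) :=
  Subtype.ext (ThreePlectic.contract_contract v w α.1)

theorem Form.contract_contract_contract_swap (u v w : VectorField E M) (α : Form E M (k + 3)) :
    contract u (contract w (contract v α)) = -contract v (contract w (contract u α)) := by
  rw [contract_contract u w, contract_contract u v, contract_contract v w, map_neg, neg_neg]

theorem Form.deRham_contract_contract [CompleteSpace E] (v w : VectorField E M)
    (α : Form E M (k + 2)) :
    deRham k (contract v (contract w α)) + contract v (deRham (k + 1) (contract w α)) =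
      contract w (deRham (k + 1) (contract v α) + contract v (deRham (k + 2) α)) +
        contract (fieldBracket v w) α :=
  Subtype.ext (lieForm_contract α.2 v w)

theorem Form.contract_deRham_contract [CompleteSpace E] (v w : VectorField E M)
    (α : Form E M 1) :
    contract v (deRham 0 (contract w α)) =
      contract w (deRham 0 (contract v α) + contract v (deRham 1 α)) +
        contract (fieldBracket v w) α :=
  Subtype.ext (contract_extD_contract α.2 v w)

theorem isHamiltonianField_iff {ϖ : Form E M (m + 2)} {α : Form E M m} {v : VectorField E M} :
    IsHamiltonianField ϖ α v ↔ deRham m α = -Form.contract v ϖ :=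
  ⟨fun h => Subtype.ext h, fun h => congrArg Subtype.val h⟩

theorem IsHamiltonianField.add {ϖ : Form E M (m + 2)} {α β : Form E M m} {v w : VectorField E M}
    (hv : IsHamiltonianField ϖ α v) (hw : IsHamiltonianField ϖ β w) :
    IsHamiltonianField ϖ (α + β) (v + w) := by
  rw [isHamiltonianField_iff] at hv hw ⊢
  rw [map_add, map_add, LinearMap.add_apply, neg_add, hv, hw]

theorem IsHamiltonianField.smul {ϖ : Form E M (m + 2)} {α : Form E M m} {v : VectorField E M}
    (hv : IsHamiltonianField ϖ α v) (c : ℝ) : IsHamiltonianField ϖ (c • α) (c • v) := by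
  rw [isHamiltonianField_iff] at hv ⊢
  rw [map_smul, map_smul, LinearMap.smul_apply, ← smul_neg, hv]

theorem IsPlectic.field_unique {ϖ : Form E M (m + 2)} (hϖ : IsPlectic (m + 1) ϖ)
    {α : Form E M m} {v w : VectorField E M} (hv : IsHamiltonianField ϖ α v)
    (hw : IsHamiltonianField ϖ α w) : v = w := by
  ext x
  have h := congrFun (neg_injective (hv.symm.trans hw)) x
  refine sub_eq_zero.1 (hϖ.nondegenerate x (v x - w x) ?_)
  exact (map_sub (ContinuousAlternatingMap.curryLeft (E := E) (ϖ.1 x)) (v x) (w x)).trans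
    (sub_eq_zero.2 h)

theorem isHamiltonianField_hamiltonianField {ϖ : Form E M (m + 2)} {α : Form E M m}
    (hα : ∃ v, IsHamiltonianField ϖ α v) : IsHamiltonianField ϖ α (hamiltonianField ϖ α) := by
  rw [hamiltonianField, dif_pos hα]
  exact hα.choose_spec

theorem IsPlectic.hamiltonianField_eq {ϖ : Form E M (m + 2)} (hϖ : IsPlectic (m + 1) ϖ)
    {α : Form E M m} {v : VectorField E M} (hv : IsHamiltonianField ϖ α v) :
    hamiltonianField ϖ α = v :=
  hϖ.field_unique (isHamiltonianField_hamiltonianField ⟨v, hv⟩) hv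

theorem IsHamiltonianField.deRham_contract {ϖ : Form E M (m + 2)} {α : Form E M m}
    {v : VectorField E M} (hv : IsHamiltonianField ϖ α v) :
    deRham (m + 1) (Form.contract v ϖ) = 0 := by
  rw [← neg_neg (Form.contract v ϖ), ← isHamiltonianField_iff.1 hv, map_neg, deRham_deRham,
    neg_zero]

theorem IsPlectic.isHamiltonianField_bracket [CompleteSpace E] {ϖ : Form E M (m + 3)}
    (hϖ : IsPlectic (m + 2) ϖ) {α β : Form E M (m + 1)} {v w : VectorField E M}
    (hv : IsHamiltonianField ϖ α v) (hw : IsHamiltonianField ϖ β w) :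
    IsHamiltonianField ϖ (Form.contract w (Form.contract v ϖ)) (fieldBracket v w) := by
  rw [isHamiltonianField_iff, Form.contract_contract, map_neg]
  have h := Form.deRham_contract_contract v w ϖ
  rw [hv.deRham_contract, hw.deRham_contract, hϖ.closed] at h
  simpa using h

namespace plecticComplex

variable {ϖ : Form E M 4}

/-- The component of degree `1`, as a smooth 1-form. -/
def oneForm (a : (plecticComplex ϖ).Tot) : Form E M 1 := a.2.1

/-- The component of degree `2`, as a smooth function. -/
def zeroForm (a : (plecticComplex ϖ).Tot) : Form E M 0 := a.2.2

theorem ext {a b : (plecticComplex ϖ).Tot} (h0 : hamForm a = hamForm b)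
    (h1 : oneForm a = oneForm b) (h2 : zeroForm a = zeroForm b) : a = b :=
  Prod.ext (Subtype.ext h0) (Prod.ext h1 h2)

@[simp]
theorem hamForm_add (a b : (plecticComplex ϖ).Tot) : hamForm (a + b) = hamForm a + hamForm b := rfl

@[simp]
theorem oneForm_add (a b : (plecticComplex ϖ).Tot) : oneForm (a + b) = oneForm a + oneForm b := rfl

@[simp]
theorem zeroForm_add (a b : (plecticComplex ϖ).Tot) :
    zeroForm (a + b) = zeroForm a + zeroForm b := rfl

@[simp]
theorem hamForm_neg (a : (plecticComplex ϖ).Tot) : hamForm (-a) = -hamForm a := rfl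

@[simp]
theorem oneForm_neg (a : (plecticComplex ϖ).Tot) : oneForm (-a) = -oneForm a := rfl

@[simp]
theorem zeroForm_neg (a : (plecticComplex ϖ).Tot) : zeroForm (-a) = -zeroForm a := rfl

@[simp]
theorem hamForm_zero : hamForm (0 : (plecticComplex ϖ).Tot) = 0 := rfl

@[simp]
theorem oneForm_zero : oneForm (0 : (plecticComplex ϖ).Tot) = 0 := rfl

@[simp]
theorem zeroForm_zero : zeroForm (0 : (plecticComplex ϖ).Tot) = 0 := rfl

@[simp]
theorem hamForm_d (a : (plecticComplex ϖ).Tot) :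
    hamForm ((plecticComplex ϖ).d a) = deRham 1 (oneForm a) := rfl

@[simp]
theorem oneForm_d (a : (plecticComplex ϖ).Tot) :
    oneForm ((plecticComplex ϖ).d a) = deRham 0 (zeroForm a) := rfl

@[simp]
theorem zeroForm_d (a : (plecticComplex ϖ).Tot) : zeroForm ((plecticComplex ϖ).d a) = 0 := rfl

theorem isHamiltonianField_hamForm (a : (plecticComplex ϖ).Tot) :
    IsHamiltonianField (m := 2) ϖ (hamForm a) (hamiltonianField (m := 2) ϖ (hamForm a)) :=
  isHamiltonianField_hamiltonianField (Subtype.property (show hamiltonianForms (m := 2) ϖ from a.1))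

/-- The Hamiltonian vector field of an element of the complex, linear because the plectic form is
non-degenerate. -/
def fieldMap (hϖ : IsPlectic 3 ϖ) : (plecticComplex ϖ).Tot →ₗ[ℝ] VectorField E M where
  toFun a := hamiltonianField (m := 2) ϖ (hamForm a)
  map_add' a b := hϖ.hamiltonianField_eq (m := 2)
    ((isHamiltonianField_hamForm a).add (isHamiltonianField_hamForm b))
  map_smul' c a := hϖ.hamiltonianField_eq (m := 2) ((isHamiltonianField_hamForm a).smul c)

variable (hϖ : IsPlectic 3 ϖ)

theorem deRham_hamForm (a : (plecticComplex ϖ).Tot) :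
    deRham 2 (hamForm a) = -Form.contract (fieldMap hϖ a) ϖ :=
  isHamiltonianField_iff.1 (isHamiltonianField_hamForm a)

theorem fieldMap_eq {a : (plecticComplex ϖ).Tot} {v : VectorField E M}
    (h : deRham 2 (hamForm a) = -Form.contract v ϖ) : fieldMap hϖ a = v :=
  hϖ.hamiltonianField_eq (m := 2) (isHamiltonianField_iff.2 h)

theorem fieldMap_eq_zero {a : (plecticComplex ϖ).Tot} (h : deRham 2 (hamForm a) = 0) :
    fieldMap hϖ a = 0 :=
  fieldMap_eq hϖ (by rw [h, map_zero]; exact neg_zero.symm)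

theorem deRham_contract_fieldMap (a : (plecticComplex ϖ).Tot) :
    deRham 3 (Form.contract (fieldMap hϖ a) ϖ) = 0 :=
  (isHamiltonianField_hamForm a).deRham_contract

theorem deRham_contract_contract_fieldMap [CompleteSpace E] (a b : (plecticComplex ϖ).Tot) :
    deRham 2 (Form.contract (fieldMap hϖ b) (Form.contract (fieldMap hϖ a) ϖ)) =
      -Form.contract (fieldBracket (fieldMap hϖ a) (fieldMap hϖ b)) ϖ :=
  isHamiltonianField_iff.1 (hϖ.isHamiltonianField_bracket (m := 1) (isHamiltonianField_hamForm a)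
    (isHamiltonianField_hamForm b))

/-- The contraction of an element with the Hamiltonian vector field of another one. -/
def contraction :
    (plecticComplex ϖ).Tot →ₗ[ℝ] (plecticComplex ϖ).Tot →ₗ[ℝ] (plecticComplex ϖ).Tot :=
  LinearMap.mk₂ ℝ (fun a b => ((0 : hamiltonianForms (m := 2) ϖ),
      Form.contract (fieldMap hϖ a) (hamForm b), Form.contract (fieldMap hϖ a) (oneForm b)))
    (fun a b c => ext (add_zero _).symm
      ((Form.contract ∘ₗ fieldMap hϖ).map_add₂ a b (hamForm c))
      ((Form.contract ∘ₗ fieldMap hϖ).map_add₂ a b (oneForm c)))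
    (fun c a b => ext (smul_zero c).symm
      ((Form.contract ∘ₗ fieldMap hϖ).map_smul₂ c a (hamForm b))
      ((Form.contract ∘ₗ fieldMap hϖ).map_smul₂ c a (oneForm b)))
    (fun a _ _ => ext (add_zero _).symm ((Form.contract (fieldMap hϖ a)).map_add _ _)
      ((Form.contract (fieldMap hϖ a)).map_add _ _))
    (fun c a b => ext (smul_zero c).symm ((Form.contract (fieldMap hϖ a)).map_smul c (hamForm b))
      ((Form.contract (fieldMap hϖ a)).map_smul c (oneForm b)))

theorem contract_contract_mem [CompleteSpace E] (a b : (plecticComplex ϖ).Tot) :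
    Form.contract (fieldMap hϖ b) (Form.contract (fieldMap hϖ a) ϖ) ∈
      hamiltonianForms (m := 2) ϖ :=
  ⟨_, isHamiltonianField_iff.2 (deRham_contract_contract_fieldMap hϖ a b)⟩

/-- The contraction of the plectic form with the Hamiltonian vector fields of two elements. -/
def hamiltonianBracket [CompleteSpace E] :
    (plecticComplex ϖ).Tot →ₗ[ℝ] (plecticComplex ϖ).Tot →ₗ[ℝ] (plecticComplex ϖ).Tot :=
  LinearMap.mk₂ ℝ (fun a b => ((⟨_, contract_contract_mem hϖ a b⟩ : hamiltonianForms (m := 2) ϖ),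
      (0 : Form E M 1), (0 : Form E M 0)))
    (fun a b c => ext
      ((congrArg _ ((Form.contract ∘ₗ fieldMap hϖ).map_add₂ a b ϖ)).trans
        ((Form.contract (fieldMap hϖ c)).map_add _ _)) (add_zero _).symm (add_zero _).symm)
    (fun c a b => ext
      ((congrArg _ ((Form.contract ∘ₗ fieldMap hϖ).map_smul₂ c a ϖ)).trans
        ((Form.contract (fieldMap hϖ b)).map_smul c _)) (smul_zero c).symm (smul_zero c).symm)
    (fun _ b c => ext ((Form.contract ∘ₗ fieldMap hϖ).map_add₂ b c _)
      (add_zero _).symm (add_zero _).symm)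
    (fun c _ b => ext ((Form.contract ∘ₗ fieldMap hϖ).map_smul₂ c b _)
      (smul_zero c).symm (smul_zero c).symm)

@[simp]
theorem hamForm_contraction (a b : (plecticComplex ϖ).Tot) :
    hamForm (contraction hϖ a b) = 0 := rfl

@[simp]
theorem oneForm_contraction (a b : (plecticComplex ϖ).Tot) :
    oneForm (contraction hϖ a b) = Form.contract (fieldMap hϖ a) (hamForm b) := rfl

@[simp]
theorem zeroForm_contraction (a b : (plecticComplex ϖ).Tot) :
    zeroForm (contraction hϖ a b) = Form.contract (fieldMap hϖ a) (oneForm b) := rfl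

theorem fieldMap_eq_zero_of_mem_negligible {a : (plecticComplex ϖ).Tot}
    (ha : a ∈ (plecticComplex ϖ).negligible) : fieldMap hϖ a = 0 := by
  obtain ⟨β, hβ⟩ := ha
  have hamForm_eq : deRham 1 β = hamForm a := congrArg Subtype.val hβ
  exact fieldMap_eq_zero hϖ ((congrArg (deRham 2) hamForm_eq.symm).trans (deRham_deRham (k := 1) β))

theorem contraction_eq_zero {a : (plecticComplex ϖ).Tot} (h : fieldMap hϖ a = 0) :
    contraction hϖ a = 0 :=
  LinearMap.ext fun b => ext rfl (by simp [h]) (by simp [h])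

variable [CompleteSpace E]

@[simp]
theorem hamForm_hamiltonianBracket (a b : (plecticComplex ϖ).Tot) :
    hamForm (hamiltonianBracket hϖ a b) =
      Form.contract (fieldMap hϖ b) (Form.contract (fieldMap hϖ a) ϖ) := rfl

@[simp]
theorem oneForm_hamiltonianBracket (a b : (plecticComplex ϖ).Tot) :
    oneForm (hamiltonianBracket hϖ a b) = 0 := rfl

@[simp]
theorem zeroForm_hamiltonianBracket (a b : (plecticComplex ϖ).Tot) :
    zeroForm (hamiltonianBracket hϖ a b) = 0 := rfl

theorem fieldMap_hamiltonianBracket (a b : (plecticComplex ϖ).Tot) :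
    fieldMap hϖ (hamiltonianBracket hϖ a b) = fieldBracket (fieldMap hϖ a) (fieldMap hϖ b) :=
  fieldMap_eq hϖ (deRham_contract_contract_fieldMap hϖ a b)

theorem hamiltonianBracket_eq_zero {a : (plecticComplex ϖ).Tot} (h : fieldMap hϖ a = 0) :
    hamiltonianBracket hϖ a = 0 :=
  LinearMap.ext fun b => ext (by simp [h]) rfl rfl

/-- The Cartan calculus of a 3-plectic manifold, given by the contraction with Hamiltonian vector
fields of forms and of the plectic form. -/
def cartanCalculus : CartanCalculus (plecticComplex ϖ) where
  ι := contraction hϖ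
  bracket := hamiltonianBracket hϖ
  ι_mem_gr := by
    rintro a b i ⟨h0, h1, -⟩
    refine ⟨fun _ => rfl, fun hi => ?_, fun hi => ?_⟩
    · have hamForm_b : hamForm b = 0 := congrArg Subtype.val (h0 (by omega))
      exact (congrArg (Form.contract (fieldMap hϖ a)) hamForm_b).trans (map_zero _)
    · have oneForm_b : oneForm b = 0 := h1 (by omega)
      exact (congrArg (Form.contract (fieldMap hϖ a)) oneForm_b).trans (map_zero _)
  bracket_mem_gr a b := ⟨fun h => absurd rfl h, fun _ => rfl, fun _ => rfl⟩
  ι_eq_zero _ ha := contraction_eq_zero hϖ (fieldMap_eq_zero_of_mem_negligible hϖ ha)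
  bracket_eq_zero _ ha := hamiltonianBracket_eq_zero hϖ (fieldMap_eq_zero_of_mem_negligible hϖ ha)
  ι_fst _ _ := rfl
  ι_ι_swap a b c := ext (by simp) (by simp) (by simpa using Form.contract_contract _ _ _)
  ι_ι_ι a b c e := ext (by simp) (by simp) (by simp)
  bracket_swap a b := ext (by simpa using Form.contract_contract _ _ _) (by simp) (by simp)
  ι_bracket_swap a b c :=
    ext (by simp) (by simpa using Form.contract_contract_contract_swap _ _ _ _) (by simp)
  lie_ι a b c := by
    refine ext (by simp) ?_ ?_
    · have h := Form.deRham_contract_contract (fieldMap hϖ a) (fieldMap hϖ b) (hamForm c)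
      rw [deRham_hamForm hϖ c, map_neg, Form.contract_contract (fieldMap hϖ a) (fieldMap hϖ c),
        neg_neg, map_add] at h
      simpa [fieldMap_hamiltonianBracket] using h
    · have h := Form.contract_deRham_contract (fieldMap hϖ a) (fieldMap hϖ b) (oneForm c)
      rw [map_add] at h
      simpa [fieldMap_hamiltonianBracket] using h
  lie_bracket a b c := by
    refine ext ?_ (by simp) (by simp)
    have h := Form.deRham_contract_contract (fieldMap hϖ a) (fieldMap hϖ c)
      (Form.contract (fieldMap hϖ b) ϖ)
    rw [Form.contract_contract (fieldMap hϖ a) (fieldMap hϖ b) ϖ, map_neg,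
      deRham_contract_contract_fieldMap, deRham_contract_contract_fieldMap,
      deRham_contract_fieldMap, map_zero, add_zero, neg_neg, map_neg,
      ← Form.contract_contract (fieldBracket _ _)] at h
    simpa [fieldMap_hamiltonianBracket] using h

end plecticComplex

end Plectic

section Structures

open scoped Manifold ContDiff
open plecticComplex

variable {E : Type u} [NormedAddCommGroup E] [NormedSpace ℝ E] [CompleteSpace E]
  {M : Type v} [TopologicalSpace M] [ChartedSpace E M] [IsManifold 𝓘(ℝ, E) ∞ M]
  {ϖ : Form E M 4} (hϖ : IsPlectic 3 ϖ)

theorem isLInfinity_lInfinity : IsLInfinity ϖ (cartanCalculus hϖ).lInfinity where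
  l2 _ _ := ⟨rfl, rfl, rfl⟩
  l3 _ _ _ := ⟨neg_zero (G := PreForm E M 2), rfl, neg_zero (G := PreForm E M 0)⟩
  l4 _ _ _ _ := ⟨neg_zero (G := PreForm E M 2), neg_zero (G := PreForm E M 1), rfl⟩
  l21 := rfl
  l211 := rfl
  l31 := rfl
  l32 := rfl

theorem hamForm_lie (a b : (plecticComplex ϖ).Tot) :
    hamForm ((cartanCalculus hϖ).lie a b) =
      deRham 1 (Form.contract (fieldMap hϖ a) (hamForm b)) +
        Form.contract (fieldMap hϖ a) (deRham 2 (hamForm b)) := by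
  rw [deRham_hamForm hϖ b, map_neg, ← Form.contract_contract]
  exact congrArg (fun α => α + _) (add_zero _)

theorem oneForm_lie (a b : (plecticComplex ϖ).Tot) :
    oneForm ((cartanCalculus hϖ).lie a b) =
      deRham 0 (Form.contract (fieldMap hϖ a) (oneForm b)) +
        Form.contract (fieldMap hϖ a) (deRham 1 (oneForm b)) :=
  add_zero _

theorem zeroForm_lie (a b : (plecticComplex ϖ).Tot) :
    zeroForm ((cartanCalculus hϖ).lie a b) =
      Form.contract (fieldMap hϖ a) (deRham 0 (zeroForm b)) :=
  (add_zero _).trans (zero_add _)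

theorem isLeib_leib : IsLeib ϖ (cartanCalculus hϖ).leib where
  l2 a b := by
    refine ⟨fun x u => ?_, fun x u => ?_, fun x u => ?_⟩
    · exact (congrArg (fun α : Form E M 2 => α.1 x u) (hamForm_lie hϖ a b)).trans
        (extD_contract_add (hamForm b).2 (fieldMap hϖ a) x u)
    · exact (congrArg (fun α : Form E M 1 => α.1 x u) (oneForm_lie hϖ a b)).trans
        (extD_contract_add (oneForm b).2 (fieldMap hϖ a) x u)
    · exact (congrArg (fun α : Form E M 0 => α.1 x u) (zeroForm_lie hϖ a b)).trans
        (contract_extD (zeroForm b).2 (fieldMap hϖ a) x u)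
  l21 _ _ := ⟨add_zero (M := PreForm E M 2) 0, rfl, rfl⟩
  l211 := rfl
  l3 := rfl
  l31 := rfl
  l32 := rfl
  l4 := rfl

theorem isComparison_comparison : IsComparison (cartanCalculus hϖ).comparison where
  f1 _ := rfl
  f2 _ _ := ⟨neg_zero (G := PreForm E M 2), rfl, rfl⟩
  f21 := rfl
  f3 a b c := ⟨rfl, congrArg Subtype.val (map_zero (Form.contract (fieldMap hϖ a))),
    contract_contract (fieldMap hϖ a) (fieldMap hϖ b) (form0 c)⟩

end Structures

end ThreePlectic

end

open scoped Manifold ContDiff in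
theorem mainTheorem6_general {E : Type*} [NormedAddCommGroup E] [NormedSpace ℝ E] [CompleteSpace E]
    {M : Type*} [TopologicalSpace M] [ChartedSpace E M] [IsManifold 𝓘(ℝ, E) ∞ M]
    (ϖ : ThreePlectic.Form E M 4) (hϖ : ThreePlectic.IsPlectic 3 ϖ) :
    ∃ (A B : ThreePlectic.WeakLie3Algebra (ThreePlectic.plecticComplex ϖ))
      (f : ThreePlectic.WeakMorphism A B),
      ThreePlectic.IsLInfinity ϖ A ∧ ThreePlectic.IsLeib ϖ B ∧
        ThreePlectic.IsComparison f ∧ f.IsIso :=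
  ⟨_, _, (ThreePlectic.plecticComplex.cartanCalculus hϖ).comparison,
    ThreePlectic.isLInfinity_lInfinity hϖ, ThreePlectic.isLeib_leib hϖ,
    ThreePlectic.isComparison_comparison hϖ,
    (ThreePlectic.plecticComplex.cartanCalculus hϖ).comparison_isIso⟩

open scoped Manifold ContDiff in
theorem mainTheorem6 {E : Type*} [NormedAddCommGroup E] [NormedSpace ℝ E] [FiniteDimensional ℝ E]
    {M : Type*} [TopologicalSpace M] [ChartedSpace E M] [IsManifold 𝓘(ℝ, E) ∞ M]
    (ϖ : ThreePlectic.Form E M 4) (hϖ : ThreePlectic.IsPlectic 3 ϖ) :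
    ∃ (A B : ThreePlectic.WeakLie3Algebra (ThreePlectic.plecticComplex ϖ))
      (f : ThreePlectic.WeakMorphism A B),
      ThreePlectic.IsLInfinity ϖ A ∧ ThreePlectic.IsLeib ϖ B ∧
        ThreePlectic.IsComparison f ∧ f.IsIso :=
  haveI := FiniteDimensional.complete ℝ E
  mainTheorem6_general ϖ hϖ
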